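/- Let $G$ be a finite connected graph (multiple edges and self-loops are allowed) with $N_G$ edges and first Betti number $h_G\ge 3$, and let $\Psi_G=\sum_{T}\prod_{e\notin T}x_e\in\mathbb{Z}[x_e : e\in E(G)]$ be its graph polynomial, where $T$ runs over the spanning trees of $G$. Orient the edges of $G$ and choose a $\mathbb{Z}$-basis $b_1,\dots,b_{h_G}$ of the lattice of cycles $H_1(G;\mathbb{Z})\subset\mathbb{Z}^{E(G)}$. For loop momenta $p_i=(p_i^+,p_i^-,p_i'^+,p_i'^-)$, $1\le i\le h_G$, let $$Q_e=Q\Big(\sum_{i=1}^{h_G} b_i(e)\,p_i\Big)\quad (e\in E(G)),\qquad\text{where}\quad Q(p)=p^+p^-+p'^+p'^-,$$ be the inverse propagators for the split metric; these are polynomials over $\mathbb{Z}$ in the $4h_G$ coordinates of the $p_i$. For a prime power $q$ and an integer polynomial $P$ let $[P]_q$ be the number of zeros of $P$ in affine space over $\mathbb{F}_q$. Then for every prime power $q$: (1) If $2h_G>N_G$, then $q^2$ divides $[\prod_{e}Q_e]_q$, and the momentum space $c_2$ invariant vanishes: $$c_2(G)^{\rm mom}_q:=[\textstyle\prod_{e}Q_e]_q/q^2\equiv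 0\mod q.$$ (2) If $2h_G=N_G$, then $q^2$ divides both $[\prod_{e}Q_e]_q$ and $[\Psi_G]_q$, and the momentum space $c_2$ invariant equals the $c_2$ invariant $c_2(G)_q:=[\Psi_G]_q/q^2 \bmod q$ in parametric space: $$c_2(G)^{\rm mom}_q\equiv c_2(G)_q\mod q.$$ -/

import Mathlib

open scoped Graph

noncomputable section

namespace Graph

variable {α β : Type*}

/-- A graph (multiple edges and self-loops allowed) is connected if it has a vertex and any two of
its vertices are joined by a path. -/
def IsConnected (G : Graph α β) : Prop :=
  V(G).Nonempty ∧ ∀ u ∈ V(G), ∀ v ∈ V(G), Relation.ReflTransGen G.Adj u v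

/-- A tree: a connected graph without cycles, that is, a connected graph in which the removal of
any edge disconnects the graph. -/
def IsTree (G : Graph α β) : Prop :=
  G.IsConnected ∧ ∀ e ∈ E(G), ¬ (G.deleteEdges {e}).IsConnected

/-- A set `T` of edges is a spanning tree of `G` if the subgraph consisting of all the vertices of
`G` and of the edges in `T` is a tree. -/
def IsSpanningTree (G : Graph α β) (T : Finset E(G)) : Prop :=
  (G.restrict (Subtype.val '' (T : Set E(G)))).IsTree

/-- The number `N_G` of edges. -/
def edgeCount (G : Graph α β) [Fintype E(G)] : ℕ := Fintype.card E(G)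

open Classical in
/-- The graph polynomial `Ψ_G = ∑_T ∏_{e ∉ T} x_e`, the sum over all spanning trees `T` of `G`. -/
def graphPolynomial (G : Graph α β) [Fintype E(G)] : MvPolynomial E(G) ℤ :=
  ∑ T : Finset E(G) with G.IsSpanningTree T, ∏ e ∈ Tᶜ, MvPolynomial.X e

/-- An orientation of the edges: every edge `e` begins at `src e` and ends at `tgt e`. -/
structure Orientation (G : Graph α β) where
  src : E(G) → V(G)
  tgt : E(G) → V(G)
  isLink : ∀ e : E(G), G.IsLink e (src e) (tgt e)

namespace Orientation

variable {G : Graph α β}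

open Classical in
/-- The incidence matrix: the entry at `(e, v)` is `1` if `e` begins and does not end at `v`, `-1`
if `e` ends and does not begin at `v`, and `0` otherwise. -/
def incidence (o : G.Orientation) : Matrix E(G) V(G) ℤ :=
  fun e v => (if o.src e = v then 1 else 0) - (if o.tgt e = v then 1 else 0)

variable [Fintype E(G)]

/-- The cycle lattice `H_1(G; ℤ) ⊆ ℤ^E`: the integral edge flows that are conserved at every
vertex. -/
def cycleLattice (o : G.Orientation) : Submodule ℤ (E(G) → ℤ) :=
  LinearMap.ker o.incidence.vecMulLinear

/-- The first Betti number `h_G`, i.e. the number of independent cycles: the rank of the cycle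
lattice. -/
def betti (o : G.Orientation) : ℕ := Module.finrank ℤ o.cycleLattice

end Orientation

end Graph

/-- The quadric of the split metric, `Q(p) = p⁺ p⁻ + p'⁺ p'⁻` for `p = (p⁺, p⁻, p'⁺, p'⁻)`. -/
def splitQuadric {R : Type*} [CommRing R] (p : Fin 4 → R) : R := p 0 * p 1 + p 2 * p 3

namespace Graph.Orientation

variable {α β : Type*} {G : Graph α β} [Fintype E(G)]

/-- The momentum flowing through the edge `e`, when the loop momenta `p_1, …, p_h` (vectors with
four coordinates, all of them variables) are routed along the basis `b` of the cycles:
`∑_i b_i(e) p_i`. -/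
def edgeMomentum (o : G.Orientation) (b : Module.Basis (Fin o.betti) ℤ o.cycleLattice) (e : E(G)) :
    Fin 4 → MvPolynomial (Fin o.betti × Fin 4) ℤ :=
  fun a => ∑ i, MvPolynomial.C ((b i : E(G) → ℤ) e) * MvPolynomial.X (i, a)

/-- The inverse propagator `Q_e` of the edge `e` in momentum space. -/
def inversePropagator (o : G.Orientation) (b : Module.Basis (Fin o.betti) ℤ o.cycleLattice)
    (e : E(G)) : MvPolynomial (Fin o.betti × Fin 4) ℤ :=
  splitQuadric (o.edgeMomentum b e)

/-- The denominator `Q_1 Q_2 ⋯ Q_{N_G}` of the momentum space integrand. -/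
def momentumDenominator (o : G.Orientation) (b : Module.Basis (Fin o.betti) ℤ o.cycleLattice) :
    MvPolynomial (Fin o.betti × Fin 4) ℤ :=
  ∏ e : E(G), o.inversePropagator b e

end Graph.Orientation

/-- The number `[P]_q` of points over the field `K = 𝔽_q` of the affine hypersurface `P = 0`, for a
polynomial `P` with integer coefficients. -/
def pointCount {σ : Type*} (P : MvPolynomial σ ℤ) (K : Type*) [Field K] : ℕ :=
  Nat.card {x : σ → K // MvPolynomial.aeval x P = 0}

/-- The hypersurface `P = 0` has a `c_n` invariant at `q = |K|`: `[P]_q ≡ 0 mod q ^ n`. -/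
def HasCInvariant {σ : Type*} (n : ℕ) (P : MvPolynomial σ ℤ) (K : Type*) [Field K] : Prop :=
  Nat.card K ^ n ∣ pointCount P K

/-- The `c_n` invariant of the hypersurface `P = 0` at `q = |K|`: the class of `[P]_q / q ^ n` in
`ℤ / q ℤ`. It is meaningful if `HasCInvariant n P K` holds, so that the division is exact. -/
def cInvariant {σ : Type*} (n : ℕ) (P : MvPolynomial σ ℤ) (K : Type*) [Field K] :
    ZMod (Nat.card K) :=
  ((pointCount P K / Nat.card K ^ n : ℕ) : ZMod (Nat.card K))

end

/-! Let `B` be the edge-by-loop matrix of the cycle basis, `h` the first Betti number, and `M(x) =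
Bᵀ diag(x) B`. By the matrix-tree theorem for cycles `det M(x) = Ψ_G(x)`, so modulo a high power of
`q` the zeros of `Ψ_G` number minus the weights `x` with `M(x)` invertible.

By inclusion-exclusion the zeros of `∏ Q_e` reduce to the common zeros of `Q_e`, `e ∈ S`. Each `Q_e`
is linear in the plus coordinates once the minus coordinates `v`, `w` are fixed. Passing to the
transposed linear system and summing over `v`, `w` gives `q ^ (2h - |S|) * ∑_x |ker M_S(x)|²` common
zeros. Corank `k` contributes `q ^ (2k)` to the sum, so modulo `q ^ 3` only coranks zero and one
count.

If `|S| = N = 2h`, two divisibilities settle the sum. Counting pairs `(x, v)` with `M(x) v = 0` by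
`v`, and triples `(x, v, w)` by `(v, w)`, shows that `q ^ 2` divides the invertible count and `q`
divides the corank-one count. So the sum agrees with the invertible count modulo `q ^ 3`, which
yields `Ψ_G`.

If `|S| < 2h`, the term vanishes modulo `q ^ 3`. Only `|S| = 2h - 1` is delicate: it needs `q ^ 2`
to divide the invertible count. Here the handshake lemma finds a cut with at most three edges of
`S`, hence a relation between at most three rows of `B`. Two proportional rows give a free weight;
three dependent rows give weights running through all symmetric `2 × 2` blocks, and those blocks are
counted explicitly (`sq_dvd_nonsingularCount_of_relation`). The hypothesis `h ≥ 3` enters as `2h - 2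
> h`. -/

set_option linter.unusedSectionVars false

/-! ### Kernels of weighted Gram matrices over a finite field -/

section FiniteFieldCounting

open Matrix Finset

variable {K : Type*} [Field K] [Fintype K] [DecidableEq K]

namespace Matrix

variable {m n ι : Type*} [Fintype m] [Fintype n] [Fintype ι]

/-- The number of vectors in the kernel of a matrix over a finite field. -/
def kerCard [DecidableEq m] [DecidableEq n] (A : Matrix m n K) : ℕ := #{v : n → K | A *ᵥ v = 0}

variable [DecidableEq m] [DecidableEq n] [DecidableEq ι]

theorem kerCard_eq_pow_finrank_ker (A : Matrix m n K) :
    A.kerCard = Fintype.card K ^ Module.finrank K (LinearMap.ker A.mulVecLin) := by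
  classical
  rw [← Nat.card_eq_fintype_card, ← Module.natCard_eq_pow_finrank (K := K), kerCard,
    ← Fintype.card_subtype, ← Nat.card_eq_fintype_card]
  exact Nat.card_congr (Equiv.subtypeEquivRight fun v => by simp)

theorem kerCard_mul_pow_rank (A : Matrix m n K) :
    A.kerCard * Fintype.card K ^ A.rank = Fintype.card K ^ Fintype.card n := by
  rw [kerCard_eq_pow_finrank_ker, ← pow_add]
  congr 1
  have := LinearMap.finrank_range_add_finrank_ker A.mulVecLin
  rw [Module.finrank_fintype_fun_eq_card] at this
  rw [Matrix.rank]
  omega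

theorem kerCard_eq_pow (A : Matrix m n K) :
    A.kerCard = Fintype.card K ^ (Fintype.card n - A.rank) := by
  have h := A.kerCard_mul_pow_rank
  have hq : 0 < Fintype.card K := Fintype.card_pos
  have hr := A.rank_le_card_width
  rw [← Nat.sub_add_cancel hr, pow_add] at h
  simpa using Nat.eq_of_mul_eq_mul_right (pow_pos hq _) h

theorem kerCard_transpose (A : Matrix m n K) :
    Aᵀ.kerCard * Fintype.card K ^ Fintype.card n =
      A.kerCard * Fintype.card K ^ Fintype.card m := by
  rw [← A.kerCard_mul_pow_rank, ← Aᵀ.kerCard_mul_pow_rank, rank_transpose]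
  ring

theorem kerCard_eq_one_iff (A : Matrix n n K) : A.kerCard = 1 ↔ A.det ≠ 0 := by
  have hq : 1 < Fintype.card K := Fintype.one_lt_card
  rw [kerCard_eq_pow_finrank_ker, Nat.pow_eq_one]
  simp only [hq.ne', false_or, Submodule.finrank_eq_zero, ← isUnit_iff_ne_zero,
    ← Matrix.isUnit_iff_isUnit_det, ← Matrix.mulVec_injective_iff_isUnit]
  rw [LinearMap.ker_eq_bot]
  rfl

theorem pow_dvd_kerCard (A : Matrix m n K) :
    Fintype.card K ^ (Fintype.card n - Fintype.card m) ∣ A.kerCard := by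
  rw [kerCard_eq_pow]
  exact pow_dvd_pow _ (Nat.sub_le_sub_left A.rank_le_card_height _)

/-- If the rows satisfy a nontrivial linear relation, then the kernel is one dimension larger than
expected. -/
theorem card_dvd_kerCard_of_vecMul_eq_zero (A : Matrix m n K) {y : m → K} (hy : y ≠ 0)
    (h : y ᵥ* A = 0) (hmn : Fintype.card m ≤ Fintype.card n) : Fintype.card K ∣ A.kerCard := by
  rw [kerCard_eq_pow]
  have h1 : Aᵀ.kerCard ≠ 1 := by
    intro h1
    rw [kerCard, Finset.card_eq_one] at h1
    obtain ⟨a, ha⟩ := h1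
    have h0 : (0 : m → K) ∈ ({a} : Finset (m → K)) := by rw [← ha]; simp
    have h2 : y ∈ ({a} : Finset (m → K)) := by
      rw [← ha]; simpa [mulVec_transpose] using h
    simp only [Finset.mem_singleton] at h0 h2
    exact hy (h2.trans h0.symm)
  have h3 : A.rank < Fintype.card m := by
    by_contra hlt
    apply h1
    rw [kerCard_eq_pow, rank_transpose, Nat.sub_eq_zero_of_le (not_lt.1 hlt), pow_zero]
  exact dvd_pow_self _ (by omega)

/-- The weighted Gram matrix `∑ x_i B_i B_iᵀ` of the rows `B_i` of a matrix `B`. -/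
def weightedGram {R : Type*} [CommRing R] (B : Matrix ι n R) (x : ι → R) : Matrix n n R :=
  Bᵀ * diagonal x * B

theorem weightedGram_mulVec {R : Type*} [CommRing R] (B : Matrix ι n R) (x : ι → R) (v : n → R) :
    B.weightedGram x *ᵥ v = (Bᵀ * diagonal (B *ᵥ v)) *ᵥ x := by
  rw [weightedGram, ← mulVec_mulVec, ← mulVec_mulVec, ← mulVec_mulVec]
  congr 1
  ext i
  simp [mulVec_diagonal, mul_comm]

/-- The number of weights for which the weighted Gram matrix is invertible. -/
def nonsingularCount (B : Matrix ι n K) : ℕ := #{x : ι → K | (B.weightedGram x).det ≠ 0}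

/-- The number of weights for which the weighted Gram matrix has corank one. -/
def corankOneCount (B : Matrix ι n K) : ℕ :=
  #{x : ι → K | (B.weightedGram x).kerCard = Fintype.card K}

/-- The number of pairs of weights and vectors in the kernel of the weighted Gram matrix. -/
def kernelSum (B : Matrix ι n K) : ℕ := ∑ x : ι → K, (B.weightedGram x).kerCard

/-- The number of triples of weights and pairs of vectors in the kernel of the weighted Gram
matrix. -/
def kernelSqSum (B : Matrix ι n K) : ℕ := ∑ x : ι → K, (B.weightedGram x).kerCard ^ 2

theorem kerCard_cases (A : Matrix m n K) :
    A.kerCard = 1 ∨ A.kerCard = Fintype.card K ∨ Fintype.card K ^ 2 ∣ A.kerCard := by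
  rw [kerCard_eq_pow_finrank_ker]
  rcases Module.finrank K (LinearMap.ker A.mulVecLin) with _ | _ | k
  · simp
  · simp
  · right; right
    exact pow_dvd_pow _ (by omega)

theorem kernelSum_modEq (B : Matrix ι n K) :
    ((Fintype.card K : ℤ) ^ 2) ∣
      B.kernelSum - (B.nonsingularCount + Fintype.card K * B.corankOneCount) := by
  have hq : 1 < Fintype.card K := Fintype.one_lt_card
  simp only [kernelSum, nonsingularCount, corankOneCount, Finset.card_filter, Nat.cast_sum,
    Finset.mul_sum, ← Finset.sum_add_distrib, ← Finset.sum_sub_distrib, ← kerCard_eq_one_iff]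
  refine Finset.dvd_sum fun x _ => ?_
  rcases (B.weightedGram x).kerCard_cases with h | h | h
  · simp [h, hq.ne]
  · simp [h, hq.ne']
  · have h1 : (B.weightedGram x).kerCard ≠ 1 := fun h1 => by
      rw [h1, Nat.dvd_one] at h; nlinarith
    have h2 : (B.weightedGram x).kerCard ≠ Fintype.card K := fun h2 => by
      rw [h2] at h; have := Nat.le_of_dvd (by omega) h; nlinarith
    simp only [h1, h2, if_false, Nat.cast_zero, mul_zero, add_zero, sub_zero]
    exact_mod_cast h

/-- A kernel of dimension `k` contributes `q ^ (2k)`, so coranks from two on contribute multiples of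
`q ^ 4`. -/
theorem kernelSqSum_modEq (B : Matrix ι n K) :
    ((Fintype.card K : ℤ) ^ 3) ∣
      B.kernelSqSum - (B.nonsingularCount + Fintype.card K ^ 2 * B.corankOneCount) := by
  have hq : 1 < Fintype.card K := Fintype.one_lt_card
  simp only [kernelSqSum, nonsingularCount, corankOneCount, Finset.card_filter, Nat.cast_sum,
    Finset.mul_sum, ← Finset.sum_add_distrib, ← Finset.sum_sub_distrib, ← kerCard_eq_one_iff]
  refine Finset.dvd_sum fun x _ => ?_
  rcases (B.weightedGram x).kerCard_cases with h | h | h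
  · simp [h, hq.ne]
  · simp [h, hq.ne']
  · have h1 : (B.weightedGram x).kerCard ≠ 1 := fun h1 => by
      rw [h1, Nat.dvd_one] at h; nlinarith
    have h2 : (B.weightedGram x).kerCard ≠ Fintype.card K := fun h2 => by
      rw [h2] at h; have := Nat.le_of_dvd (by omega) h; nlinarith
    simp only [h1, h2, if_false, Nat.cast_zero, mul_zero, add_zero, sub_zero]
    have : Fintype.card K ^ 3 ∣ (B.weightedGram x).kerCard ^ 2 :=
      (pow_dvd_pow _ (by norm_num : 3 ≤ 2 * 2)).trans (by rw [pow_mul]; exact pow_dvd_pow_of_dvd h 2)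
    exact_mod_cast this

/-- Double counting of pairs `(x, v)`: the condition `M(x) v = 0` is linear in `x` for fixed `v`. -/
theorem kernelSum_eq (B : Matrix ι n K) :
    B.kernelSum = ∑ v : n → K, (Bᵀ * diagonal (B *ᵥ v)).kerCard := by
  simp only [kernelSum, kerCard, Finset.card_filter]
  rw [Finset.sum_comm]
  simp only [weightedGram_mulVec]

theorem pow_dvd_kernelSum (B : Matrix ι n K) :
    Fintype.card K ^ (Fintype.card ι - Fintype.card n) ∣ B.kernelSum := by
  rw [kernelSum_eq]
  exact Finset.dvd_sum fun v _ => pow_dvd_kerCard _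

/-- The matrix of the linear map which sends the weights to the images of `v` and `w` under the
weighted Gram matrix. -/
def pairMatrix (B : Matrix ι n K) (v w : n → K) : Matrix (n ⊕ n) ι K :=
  fromRows (Bᵀ * diagonal (B *ᵥ v)) (Bᵀ * diagonal (B *ᵥ w))

theorem pairMatrix_mulVec_eq_zero_iff (B : Matrix ι n K) (v w : n → K) (x : ι → K) :
    B.pairMatrix v w *ᵥ x = 0 ↔ B.weightedGram x *ᵥ v = 0 ∧ B.weightedGram x *ᵥ w = 0 := by
  rw [pairMatrix, fromRows_mulVec, weightedGram_mulVec, weightedGram_mulVec, ← Sum.elim_zero_zero,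
    Sum.elim_eq_iff]

theorem kernelSqSum_eq (B : Matrix ι n K) :
    B.kernelSqSum = ∑ v : n → K, ∑ w : n → K, (B.pairMatrix v w).kerCard := by
  have h : ∀ x : ι → K, (B.weightedGram x).kerCard ^ 2 =
      ∑ v : n → K, ∑ w : n → K, if B.pairMatrix v w *ᵥ x = 0 then 1 else 0 := by
    intro x
    simp only [sq, kerCard, Finset.card_filter, Finset.sum_mul_sum, pairMatrix_mulVec_eq_zero_iff,
      ← ite_and, ite_mul, one_mul, zero_mul]
  rw [kernelSqSum, Finset.sum_congr rfl fun x _ => h x, Finset.sum_comm]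
  refine Finset.sum_congr rfl fun v _ => ?_
  rw [Finset.sum_comm]
  simp only [kerCard, Finset.card_filter]

theorem pairMatrix_zero_left_kerCard (B : Matrix ι n K) (w : n → K) :
    (B.pairMatrix 0 w).kerCard = (Bᵀ * diagonal (B *ᵥ w)).kerCard := by
  simp only [kerCard, pairMatrix_mulVec_eq_zero_iff, mulVec_zero, true_and, weightedGram_mulVec]

theorem pairMatrix_add_smul_kerCard (B : Matrix ι n K) (v w : n → K) (t : K) :
    (B.pairMatrix v (w + t • v)).kerCard = (B.pairMatrix v w).kerCard := by
  simp only [kerCard, pairMatrix_mulVec_eq_zero_iff, mulVec_add, mulVec_smul]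
  congr 1
  ext x
  simp only [Finset.mem_filter, Finset.mem_univ, true_and]
  constructor <;> rintro ⟨h1, h2⟩ <;> simp_all

/-- The symmetry `w · M(x) v = v · M(x) w` is a relation `(w, -v)` between the `2h` rows, so the
rank drops below `2h`. -/
theorem card_dvd_pairMatrix_kerCard (B : Matrix ι n K) {v : n → K} (hv : v ≠ 0) (w : n → K)
    (h : 2 * Fintype.card n ≤ Fintype.card ι) : Fintype.card K ∣ (B.pairMatrix v w).kerCard := by
  refine card_dvd_kerCard_of_vecMul_eq_zero _ (y := Sum.elim w (-v)) ?_ ?_ ?_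
  · intro h0
    apply hv
    ext i
    simpa using congrFun h0 (Sum.inr i)
  · ext i
    rw [pairMatrix, vecMul_fromRows]
    simp [← vecMul_vecMul, vecMul_diagonal, vecMul_transpose, mulVec_neg, mul_comm]
  · rw [Fintype.card_sum]
    omega

end Matrix

/-- A divisibility of sums over all cosets of a subgroup gives the divisibility of the total sum. -/
theorem Finset.dvd_sum_of_dvd_sum_coset {X : Type*} [AddCommGroup X] [Fintype X]
    (s : AddSubgroup X) [Fintype s] (f : X → ℕ) (d : ℕ)
    (h : ∀ x, d ∣ ∑ y : s, f (x + y)) : d ∣ ∑ x, f x := by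
  classical
  have key : ∑ x, f x = ∑ c : X ⧸ s, ∑ y : s, f (c.out + y) := by
    have h1 : ∀ c : X ⧸ s, ∑ y : s, f (c.out + y) =
        ∑ x with (QuotientAddGroup.mk x : X ⧸ s) = c, f x := by
      intro c
      refine Finset.sum_bij (fun y _ => c.out + y) ?_ ?_ ?_ ?_
      · intro y _
        simp
      · intro y _ z _ hyz
        simpa using hyz
      · intro x hx
        simp only [Finset.mem_filter, Finset.mem_univ, true_and] at hx
        refine ⟨⟨-c.out + x, ?_⟩, Finset.mem_univ _, by simp⟩
        rw [← QuotientAddGroup.eq]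
        simp [hx]
      · intro _ _
        rfl
    rw [Finset.sum_congr rfl fun c _ => h1 c]
    exact (Finset.sum_fiberwise _ _ _).symm
  rw [key]
  exact Finset.dvd_sum fun c _ => h _

namespace Matrix

variable {n ι : Type*} [Fintype n] [Fintype ι] [DecidableEq n] [DecidableEq ι]

/-- For `v ≠ 0`, one factor `q` comes from the symmetry relation and another from the invariance of
the count under `w ↦ w + t v`. -/
theorem sq_dvd_kernelSqSum (B : Matrix ι n K) (h : 2 * Fintype.card n ≤ Fintype.card ι)
    (hn : 2 ≤ Fintype.card n) : Fintype.card K ^ 2 ∣ B.kernelSqSum := by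
  classical
  rw [kernelSqSum_eq, ← Finset.add_sum_erase _ _ (Finset.mem_univ (0 : n → K))]
  refine dvd_add ?_ (Finset.dvd_sum fun v hv => ?_)
  -- The terms with `v = 0` add up to the sum over pairs, which is divisible by `q ^ (|ι| - |n|)`.
  · simp only [pairMatrix_zero_left_kerCard, ← kernelSum_eq]
    exact (pow_dvd_pow _ (by omega)).trans B.pow_dvd_kernelSum
  · have hv : v ≠ 0 := Finset.ne_of_mem_erase hv
    refine Finset.dvd_sum_of_dvd_sum_coset (Submodule.span K {v}).toAddSubgroup _ _ fun w => ?_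
    have hc : ∀ y : (Submodule.span K {v}).toAddSubgroup,
        (B.pairMatrix v (w + y)).kerCard = (B.pairMatrix v w).kerCard := by
      rintro ⟨y, hy⟩
      obtain ⟨t, rfl⟩ := Submodule.mem_span_singleton.1 hy
      exact B.pairMatrix_add_smul_kerCard v w t
    have hcard : Fintype.card (Submodule.span K {v}).toAddSubgroup = Fintype.card K := by
      have h1 := Module.natCard_eq_pow_finrank (K := K) (V := Submodule.span K {v})
      rw [finrank_span_singleton hv, pow_one, Nat.card_eq_fintype_card (α := K)] at h1
      rw [← h1, ← Nat.card_eq_fintype_card]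
      rfl
    rw [Finset.sum_congr rfl fun y _ => hc y, Finset.sum_const, Finset.card_univ, hcard, sq,
      smul_eq_mul]
    exact mul_dvd_mul_left _ (B.card_dvd_pairMatrix_kerCard hv w h)

theorem card_dvd_nonsingularCount (B : Matrix ι n K) (h : Fintype.card n < Fintype.card ι) :
    Fintype.card K ∣ B.nonsingularCount := by
  have h1 : (Fintype.card K : ℤ) ∣ B.kernelSum := by
    exact_mod_cast (dvd_pow_self _ (by omega)).trans B.pow_dvd_kernelSum
  have h2 := (dvd_pow_self (Fintype.card K : ℤ) two_ne_zero).trans B.kernelSum_modEq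
  obtain ⟨a, ha⟩ := h1
  obtain ⟨c, hc⟩ := h2
  have : (Fintype.card K : ℤ) ∣ B.nonsingularCount :=
    ⟨a - B.corankOneCount - c, by linear_combination ha - hc⟩
  exact_mod_cast this

theorem card_dvd_kernelSqSum (B : Matrix ι n K) (h : Fintype.card n < Fintype.card ι) :
    Fintype.card K ∣ B.kernelSqSum := by
  have h1 : (Fintype.card K : ℤ) ∣ B.nonsingularCount := by
    exact_mod_cast B.card_dvd_nonsingularCount h
  have h2 := (dvd_pow_self (Fintype.card K : ℤ) three_ne_zero).trans B.kernelSqSum_modEq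
  obtain ⟨a, ha⟩ := h1
  obtain ⟨c, hc⟩ := h2
  have : (Fintype.card K : ℤ) ∣ B.kernelSqSum :=
    ⟨a + c + Fintype.card K * B.corankOneCount, by linear_combination ha + hc⟩
  exact_mod_cast this

theorem sq_dvd_kernelSqSum_of_nonsingularCount (B : Matrix ι n K)
    (h : Fintype.card K ^ 2 ∣ B.nonsingularCount) : Fintype.card K ^ 2 ∣ B.kernelSqSum := by
  have h1 : (Fintype.card K : ℤ) ^ 2 ∣ B.nonsingularCount := by exact_mod_cast h
  have h2 := (pow_dvd_pow (Fintype.card K : ℤ) (by norm_num : 2 ≤ 3)).trans B.kernelSqSum_modEq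
  obtain ⟨a, ha⟩ := h1
  obtain ⟨c, hc⟩ := h2
  have : (Fintype.card K : ℤ) ^ 2 ∣ B.kernelSqSum :=
    ⟨a + c + B.corankOneCount, by linear_combination ha + hc⟩
  exact_mod_cast this

theorem sq_dvd_nonsingularCount (B : Matrix ι n K) (h : 2 * Fintype.card n ≤ Fintype.card ι)
    (hn : 2 ≤ Fintype.card n) : Fintype.card K ^ 2 ∣ B.nonsingularCount := by
  have h1 : (Fintype.card K : ℤ) ^ 2 ∣ B.kernelSqSum := by exact_mod_cast B.sq_dvd_kernelSqSum h hn
  have h2 := (pow_dvd_pow (Fintype.card K : ℤ) (by norm_num : 2 ≤ 3)).trans B.kernelSqSum_modEq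
  obtain ⟨a, ha⟩ := h1
  obtain ⟨c, hc⟩ := h2
  have : (Fintype.card K : ℤ) ^ 2 ∣ B.nonsingularCount :=
    ⟨a - c - B.corankOneCount, by linear_combination ha - hc⟩
  exact_mod_cast this

/-- Since `q ^ 2` divides both the sum of kernel sizes and the invertible count, their comparison
modulo `q ^ 2` makes the corank-one count a multiple of `q`; its contribution `q ^ 2 *
corankOneCount` then disappears. -/
theorem cube_dvd_kernelSqSum_sub_nonsingularCount (B : Matrix ι n K)
    (h : 2 * Fintype.card n ≤ Fintype.card ι) (hn : 2 ≤ Fintype.card n) :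
    (Fintype.card K : ℤ) ^ 3 ∣ B.kernelSqSum - B.nonsingularCount := by
  have hq : (Fintype.card K : ℤ) ≠ 0 := by exact_mod_cast Fintype.card_ne_zero
  have h1 : (Fintype.card K : ℤ) ^ 2 ∣ B.nonsingularCount := by
    exact_mod_cast B.sq_dvd_nonsingularCount h hn
  have h2 : (Fintype.card K : ℤ) ^ 2 ∣ B.kernelSum := by
    exact_mod_cast (pow_dvd_pow (Fintype.card K) (by omega)).trans B.pow_dvd_kernelSum
  obtain ⟨a, ha⟩ := h1
  obtain ⟨c, hc⟩ := h2
  obtain ⟨d, hd⟩ := B.kernelSum_modEq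
  obtain ⟨f, hf⟩ := B.kernelSqSum_modEq
  have h3 : (B.corankOneCount : ℤ) = Fintype.card K * (c - a - d) :=
    mul_left_cancel₀ hq (by linear_combination hc - ha - hd)
  exact ⟨f + (c - a - d), by linear_combination hf + (Fintype.card K : ℤ) ^ 2 * h3⟩

/-- The number of common zeros of the quadrics `Q(B_i p)`. -/
theorem card_common_zeros_mul (B : Matrix ι n K) :
    #{p : n × Fin 4 → K | ∀ i, splitQuadric (fun a => ∑ j, B i j * p (j, a)) = 0} *
        Fintype.card K ^ Fintype.card ι =
      Fintype.card K ^ (2 * Fintype.card n) * B.kernelSqSum := by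
  -- The minus coordinates become the parameters `(v, w)`; the plus coordinates are the unknowns of
  -- a linear system with matrix `(B.pairMatrix v w)ᵀ`.
  let e : (n × Fin 4 → K) ≃ ((n → K) × (n → K)) × (n ⊕ n → K) :=
    { toFun := fun p => ((fun j => p (j, 1), fun j => p (j, 3)),
        Sum.elim (fun j => p (j, 0)) (fun j => p (j, 2)))
      invFun := fun y ja =>
        ![y.2 (Sum.inl ja.1), y.1.1 ja.1, y.2 (Sum.inr ja.1), y.1.2 ja.1] ja.2
      left_inv := fun p => by
        ext ⟨j, a⟩
        fin_cases a <;> rfl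
      right_inv := fun y => by
        refine Prod.ext rfl ?_
        ext (j | j) <;> rfl }
  have he : ∀ p, (∀ i, splitQuadric (fun a => ∑ j, B i j * p (j, a)) = 0) ↔
      (B.pairMatrix (e p).1.1 (e p).1.2)ᵀ *ᵥ (e p).2 = 0 := by
    intro p
    rw [mulVec_transpose, pairMatrix, vecMul_fromRows, funext_iff]
    refine forall_congr' fun i => ?_
    simp only [e, splitQuadric, Equiv.coe_fn_mk, Sum.elim_comp_inl, Sum.elim_comp_inr,
      ← vecMul_vecMul, vecMul_transpose, Pi.add_apply, vecMul_diagonal, Pi.zero_apply]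
    rfl
  have hc : #{p : n × Fin 4 → K | ∀ i, splitQuadric (fun a => ∑ j, B i j * p (j, a)) = 0} =
      ∑ v : n → K, ∑ w : n → K, (B.pairMatrix v w)ᵀ.kerCard := by
    simp only [kerCard, Finset.card_filter, he]
    rw [Equiv.sum_comp e fun y => if (B.pairMatrix y.1.1 y.1.2)ᵀ *ᵥ y.2 = 0 then 1 else 0,
      Fintype.sum_prod_type, Fintype.sum_prod_type]
  rw [hc, kernelSqSum_eq]
  simp only [Finset.sum_mul, kerCard_transpose, Finset.mul_sum, Fintype.card_sum, two_mul]
  simp only [mul_comm]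

end Matrix

end FiniteFieldCounting

/-! ### Short relations between rows, and the Cauchy-Binet formula -/

section FewRelations

open Matrix Finset

variable {K : Type*} [Field K] [Fintype K] [DecidableEq K]

theorem card_filter_linear_eq_zero (α β : K) :
    #{a : K | α * a + β = 0} = if α = 0 then (if β = 0 then Fintype.card K else 0) else 1 := by
  split_ifs with h1 h2
  · simp [h1, h2, Finset.card_univ]
  · simp [h1, h2]
  · rw [Finset.card_eq_one]
    refine ⟨-β / α, ?_⟩
    ext a
    simp only [Finset.mem_filter, Finset.mem_univ, true_and, Finset.mem_singleton]
    rw [eq_div_iff h1]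
    constructor <;> intro h <;> linear_combination h

/-- The symmetric `2 × 2` matrices `S` for which `1 + S * N` is invertible, for a given symmetric
`2 × 2` matrix `N`. -/
theorem sq_dvd_card_det_one_add_symm_mul_ne_zero (l m n : K) :
    Fintype.card K ^ 2 ∣ #{y : K × K × K | 1 + y.1 * l + 2 * y.2.1 * m + y.2.2 * n +
      (y.1 * y.2.2 - y.2.1 ^ 2) * (l * n - m ^ 2) ≠ 0} := by
  suffices h : Fintype.card K ^ 2 ∣ #{y : K × K × K | 1 + y.1 * l + 2 * y.2.1 * m + y.2.2 * n +
      (y.1 * y.2.2 - y.2.1 ^ 2) * (l * n - m ^ 2) = 0} by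
    have htot := Finset.card_filter_add_card_filter_not (s := (univ : Finset (K × K × K)))
      (fun y : K × K × K => 1 + y.1 * l + 2 * y.2.1 * m + y.2.2 * n +
        (y.1 * y.2.2 - y.2.1 ^ 2) * (l * n - m ^ 2) = 0)
    refine (Nat.dvd_add_right h).1 ?_
    rw [htot, Finset.card_univ, Fintype.card_prod, Fintype.card_prod]
    exact ⟨Fintype.card K, by ring⟩
  have hsum : #{y : K × K × K | 1 + y.1 * l + 2 * y.2.1 * m + y.2.2 * n +
      (y.1 * y.2.2 - y.2.1 ^ 2) * (l * n - m ^ 2) = 0} = ∑ a : K, ∑ b : K, ∑ c : K,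
        if 1 + a * l + 2 * b * m + c * n + (a * c - b ^ 2) * (l * n - m ^ 2) = 0 then 1 else 0 := by
    rw [Finset.card_filter, Fintype.sum_prod_type]
    simp only [Fintype.sum_prod_type]
  -- If `N` is singular the equation is affine linear: it has `q ^ 2` solutions, or none when `N =
  -- 0`.
  by_cases hΔ : l * n - m ^ 2 = 0
  · by_cases hn : n = 0
    · by_cases hl : l = 0
      · have hm : m = 0 := by simpa [hl, hn] using hΔ
        simp [hl, hn, hm]
      · have h1 : ∀ b c : K, (∑ a : K,
            if 1 + a * l + 2 * b * m + c * n + (a * c - b ^ 2) * (l * n - m ^ 2) = 0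
              then 1 else 0) = 1 := by
          intro b c
          rw [← Finset.card_filter]
          have := card_filter_linear_eq_zero l (1 + 2 * b * m + c * n)
          rw [if_neg hl] at this
          refine Eq.trans ?_ this
          congr 1
          ext a
          simp only [Finset.mem_filter, Finset.mem_univ, true_and, hΔ]
          ring_nf
        have h2 : ∀ f : K → K → K → ℕ, ∑ a, ∑ b, ∑ c, f a b c = ∑ b, ∑ c, ∑ a, f a b c := by
          intro f
          rw [Finset.sum_comm]
          exact Finset.sum_congr rfl fun b _ => Finset.sum_comm
        rw [hsum, h2]
        simp only [h1, Finset.sum_const, Finset.card_univ, smul_eq_mul]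
        exact ⟨1, by ring⟩
    · have h1 : ∀ a b : K, (∑ c : K,
          if 1 + a * l + 2 * b * m + c * n + (a * c - b ^ 2) * (l * n - m ^ 2) = 0
            then 1 else 0) = 1 := by
        intro a b
        rw [← Finset.card_filter]
        have := card_filter_linear_eq_zero n (1 + 2 * b * m + a * l)
        rw [if_neg hn] at this
        refine Eq.trans ?_ this
        congr 1
        ext c
        simp only [Finset.mem_filter, Finset.mem_univ, true_and, hΔ]
        ring_nf
      rw [hsum]
      simp only [h1, Finset.sum_const, Finset.card_univ, smul_eq_mul]
      exact ⟨1, by ring⟩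
  -- Each `a` admits exactly `q` pairs `(b, c)`: the equation is linear in `c`, and where its
  -- coefficient `n + a Δ` vanishes it degenerates to `(b Δ - m) ^ 2 = 0` with `c` free. No division
  -- by two occurs, so characteristic two is included.
  · set Δ := l * n - m ^ 2 with hΔdef
    have h1 : ∀ a b : K, (∑ c : K,
        if 1 + a * l + 2 * b * m + c * n + (a * c - b ^ 2) * Δ = 0 then 1 else 0) =
          if n + a * Δ = 0 then (if b = m / Δ then Fintype.card K else 0) else 1 := by
      intro a b
      rw [← Finset.card_filter]
      have h2 := card_filter_linear_eq_zero (n + a * Δ) (1 + a * l + 2 * b * m - b ^ 2 * Δ)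
      have h3 : #{c : K | 1 + a * l + 2 * b * m + c * n + (a * c - b ^ 2) * Δ = 0} =
          #{c : K | (n + a * Δ) * c + (1 + a * l + 2 * b * m - b ^ 2 * Δ) = 0} := by
        congr 1
        ext c
        simp only [Finset.mem_filter, Finset.mem_univ, true_and]
        ring_nf
      rw [h3, h2]
      by_cases h4 : n + a * Δ = 0
      · rw [if_pos h4, if_pos h4]
        have h5 : 1 + a * l + 2 * b * m - b ^ 2 * Δ = 0 ↔ b = m / Δ := by
          rw [eq_div_iff hΔ, ← sub_eq_zero (a := b * Δ), ← sq_eq_zero_iff (a := b * Δ - m)]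
          have h6 : (b * Δ - m) ^ 2 = -(Δ * (1 + a * l + 2 * b * m - b ^ 2 * Δ)) := by
            linear_combination l * h4 + hΔdef
          rw [h6, neg_eq_zero, mul_eq_zero]
          simp [hΔ]
        simp only [h5]
      · rw [if_neg h4, if_neg h4]
    have h7 : ∀ a : K, (∑ b : K, if n + a * Δ = 0 then
        (if b = m / Δ then Fintype.card K else 0) else 1) = Fintype.card K := by
      intro a
      split_ifs <;> simp [Finset.card_univ]
    rw [hsum]
    simp only [h1, h7, Finset.sum_const, Finset.card_univ, smul_eq_mul]
    exact ⟨1, by ring⟩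

theorem Finset.dvd_sum_of_dvd_sum_translate {X Y : Type*} [AddCommGroup X] [Fintype X]
    [AddCommGroup Y] [Fintype Y] (φ : Y →+ X) (hφ : Function.Injective φ) (f : X → ℕ) (d : ℕ)
    (h : ∀ x, d ∣ ∑ y, f (x + φ y)) : d ∣ ∑ x, f x := by
  classical
  refine Finset.dvd_sum_of_dvd_sum_coset φ.range f d fun x => ?_
  rw [← Equiv.sum_comp (AddMonoidHom.ofInjective hφ).toEquiv]
  exact h x

namespace Matrix

variable {n ι : Type*} [Fintype n] [Fintype ι] [DecidableEq n] [DecidableEq ι]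

/-- The symmetric `2 × 2` blocks whose addition makes a symmetric matrix invertible. -/
theorem sq_dvd_card_det_add_symm_ne_zero (M : Matrix n n K) (hM : M.IsSymm) (u w : n → K) :
    Fintype.card K ^ 2 ∣ #{y : K × K × K | (M + (y.1 • vecMulVec u u +
      y.2.1 • (vecMulVec u w + vecMulVec w u) + y.2.2 • vecMulVec w w)).det ≠ 0} := by
  set F : K × K × K → Matrix n n K := fun y => y.1 • vecMulVec u u +
      y.2.1 • (vecMulVec u w + vecMulVec w u) + y.2.2 • vecMulVec w w with hF
  have hFadd : ∀ y z, F (y + z) = F y + F z := by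
    intro y z
    simp only [hF, Prod.fst_add, Prod.snd_add, add_smul]
    abel
  have hFsymm : ∀ y, (F y).IsSymm := by
    intro y
    simp only [hF, IsSymm, transpose_add, transpose_smul, transpose_vecMulVec]
    rw [add_comm (vecMulVec w u)]
  change _ ∣ #{y | (M + F y).det ≠ 0}
  -- Recentring at an invertible member of the family allows the matrix determinant lemma, which
  -- reduces the determinant to size `2 × 2`.
  by_cases h0 : ∃ y, (M + F y).det ≠ 0
  swap
  · push Not at h0
    simp [h0]
  obtain ⟨y₀, hy₀⟩ := h0
  set A := M + F y₀ with hA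
  have hAsymm : A.IsSymm := hM.add (hFsymm y₀)
  have hshift : #{y | (M + F y).det ≠ 0} = #{y | (A + F y).det ≠ 0} := by
    simp only [Finset.card_filter]
    rw [← Equiv.sum_comp (Equiv.addLeft y₀)]
    simp only [Equiv.coe_addLeft, hFadd, hA, add_assoc]
  rw [hshift]
  let U : Matrix n (Fin 2) K := of fun i a => ![u i, w i] a
  let N := Uᵀ * A⁻¹ * U
  have hN : N.IsSymm := by
    simp only [N, IsSymm, transpose_mul, transpose_transpose, transpose_nonsing_inv, hAsymm.eq,
      Matrix.mul_assoc]
  have hFU : ∀ y : K × K × K, F y = U * (!![y.1, y.2.1; y.2.1, y.2.2] * Uᵀ) := by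
    intro y
    ext i j
    simp [hF, U, Matrix.mul_apply, Fin.sum_univ_two, vecMulVec_apply, Matrix.vecMul]
    ring
  have hdet : ∀ y : K × K × K, (A + F y).det = A.det * (1 + y.1 * N 0 0 + 2 * y.2.1 * N 0 1 +
      y.2.2 * N 1 1 + (y.1 * y.2.2 - y.2.1 ^ 2) * (N 0 0 * N 1 1 - N 0 1 ^ 2)) := by
    intro y
    have h10 : N 1 0 = N 0 1 := hN.apply 0 1
    rw [hFU, det_add_mul _ _ (isUnit_iff_ne_zero.2 hy₀)]
    congr 1
    have : !![y.1, y.2.1; y.2.1, y.2.2] * Uᵀ * A⁻¹ * U = !![y.1, y.2.1; y.2.1, y.2.2] * N := by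
      simp only [N, Matrix.mul_assoc]
    rw [this, det_fin_two]
    simp [Matrix.vecMul, dotProduct, Fin.sum_univ_two, h10]
    ring
  simp only [hdet, ne_eq, mul_eq_zero, hy₀, false_or]
  exact sq_dvd_card_det_one_add_symm_mul_ne_zero (N 0 0) (N 0 1) (N 1 1)

theorem weightedGram_apply {R : Type*} [CommRing R] (B : Matrix ι n R) (x : ι → R) (j k : n) :
    B.weightedGram x j k = ∑ i, x i * (B i j * B i k) := by
  rw [weightedGram, Matrix.mul_apply]
  refine Finset.sum_congr rfl fun i _ => ?_
  rw [Matrix.mul_diagonal, transpose_apply]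
  ring

theorem weightedGram_isSymm {R : Type*} [CommRing R] (B : Matrix ι n R) (x : ι → R) :
    (B.weightedGram x).IsSymm := by
  ext j k
  simp only [transpose_apply, weightedGram_apply, mul_comm (B _ k)]

theorem weightedGram_add {R : Type*} [CommRing R] (B : Matrix ι n R) (x y : ι → R) :
    B.weightedGram (x + y) = B.weightedGram x + B.weightedGram y := by
  ext j k
  simp only [add_apply, weightedGram_apply, Pi.add_apply, add_mul, Finset.sum_add_distrib]

theorem weightedGram_single {R : Type*} [CommRing R] (B : Matrix ι n R) (i : ι) (t : R) :
    B.weightedGram (Pi.single i t) = t • vecMulVec (B i) (B i) := by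
  ext j k
  rw [weightedGram_apply, Finset.sum_eq_single i]
  · simp [vecMulVec_apply]
  · intro b _ hb
    simp [Pi.single_eq_of_ne hb]
  · simp

/-- The weight `s` of the row `t • B f` can be absorbed by shifting the weight of `f` by `s * t ^
2`, which leaves `s` free. -/
theorem nonsingularCount_eq_card_mul (B : Matrix ι n K) {e f : ι} (hef : f ≠ e) (t : K)
    (h : B e = t • B f) :
    B.nonsingularCount =
      Fintype.card K * (B.submatrix (Subtype.val : {i // i ≠ e} → ι) id).nonsingularCount := by
  set B' := B.submatrix (Subtype.val : {i // i ≠ e} → ι) id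
  have hsplit : ∀ (s : K) (y : {i // i ≠ e} → K),
      B.weightedGram ((Equiv.funSplitAt e K).symm (s, y)) =
        B'.weightedGram (y + Pi.single ⟨f, hef⟩ (s * t ^ 2)) := by
    intro s y
    rw [weightedGram_add, weightedGram_single]
    ext j k
    have hy : ∀ i : {i // i ≠ e}, (Equiv.funSplitAt e K).symm (s, y) i = y i := fun i => by
      simp [Equiv.funSplitAt, Equiv.piSplitAt, i.2]
    have hs : (Equiv.funSplitAt e K).symm (s, y) e = s := by
      simp [Equiv.funSplitAt, Equiv.piSplitAt]
    rw [weightedGram_apply, Fintype.sum_eq_add_sum_subtype_ne _ e, hs, h, add_apply,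
      weightedGram_apply, smul_apply, vecMulVec_apply]
    simp only [hy, Pi.smul_apply, smul_eq_mul, B', submatrix_apply, id]
    ring
  simp only [nonsingularCount, Finset.card_filter]
  rw [← Equiv.sum_comp (Equiv.funSplitAt e K).symm, Fintype.sum_prod_type]
  simp only [hsplit]
  have hinner : ∀ s : K, (∑ y : {i // i ≠ e} → K,
      if (B'.weightedGram (y + Pi.single ⟨f, hef⟩ (s * t ^ 2))).det ≠ 0 then 1 else 0) =
        ∑ y : {i // i ≠ e} → K, if (B'.weightedGram y).det ≠ 0 then 1 else 0 := fun s =>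
    Equiv.sum_comp (Equiv.addRight (Pi.single ⟨f, hef⟩ (s * t ^ 2) : {i // i ≠ e} → K))
      fun y => if (B'.weightedGram y).det ≠ 0 then 1 else 0
  rw [Finset.sum_congr rfl fun s _ => hinner s, Finset.sum_const, Finset.card_univ, smul_eq_mul]

theorem sq_dvd_nonsingularCount_of_proportional (B : Matrix ι n K) {e f : ι} (hef : f ≠ e) (t : K)
    (h : B e = t • B f) (hcard : Fintype.card n + 2 ≤ Fintype.card ι) :
    Fintype.card K ^ 2 ∣ B.nonsingularCount := by
  rw [B.nonsingularCount_eq_card_mul hef t h, sq]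
  refine mul_dvd_mul_left _ (card_dvd_nonsingularCount _ ?_)
  rw [Fintype.card_subtype_compl, Fintype.card_subtype_eq]
  omega

/-- The squares of `B e`, `B f`, `B g` generate all symmetric combinations of `B f` and `B g`, so
the weights split into cosets on each of which the symmetric-block count applies. -/
theorem sq_dvd_nonsingularCount_of_three_term (B : Matrix ι n K) {e f g : ι} (hef : e ≠ f)
    (heg : e ≠ g) (hfg : f ≠ g) {s t : K} (hs : s ≠ 0) (ht : t ≠ 0) (h : B e = s • B f + t • B g) :
    Fintype.card K ^ 2 ∣ B.nonsingularCount := by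
  -- Weight `b / (s * t)` on `e` produces the mixed term with coefficient `b`; the corrections on
  -- `f` and `g` cancel the squares it brings along.
  let φ : K × K × K →+ (ι → K) :=
    { toFun := fun y => Pi.single e (y.2.1 / (s * t)) + Pi.single f (y.1 - s / t * y.2.1) +
        Pi.single g (y.2.2 - t / s * y.2.1)
      map_zero' := by simp
      map_add' := fun y z => by
        ext i
        simp only [Pi.add_apply, Prod.fst_add, Prod.snd_add, Pi.single_apply]
        split_ifs <;> ring }
  have hφ : Function.Injective φ := by
    rw [injective_iff_map_eq_zero]
    intro y hy
    have he := congrFun hy e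
    have hf := congrFun hy f
    have hg := congrFun hy g
    simp only [φ, AddMonoidHom.coe_mk, ZeroHom.coe_mk, Pi.add_apply, Pi.single_apply, hef, hef.symm,
      heg, heg.symm, hfg, hfg.symm, if_true, if_false, add_zero, zero_add, Pi.zero_apply,
      div_eq_zero_iff, mul_eq_zero, hs, ht, or_false] at he hf hg
    rw [he, mul_zero, sub_zero] at hf hg
    exact Prod.ext hf (Prod.ext he hg)
  have hgram : ∀ x y, B.weightedGram (x + φ y) = B.weightedGram x + (y.1 • vecMulVec (B f) (B f) +
      y.2.1 • (vecMulVec (B f) (B g) + vecMulVec (B g) (B f)) + y.2.2 • vecMulVec (B g) (B g)) := by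
    intro x y
    simp only [φ, AddMonoidHom.coe_mk, ZeroHom.coe_mk, weightedGram_add, weightedGram_single, h]
    congr 1
    ext j k
    simp only [add_apply, smul_apply, vecMulVec_apply, Pi.add_apply, Pi.smul_apply, smul_eq_mul]
    field_simp
    ring
  rw [nonsingularCount, Finset.card_filter]
  refine Finset.dvd_sum_of_dvd_sum_translate φ hφ _ _ fun x => ?_
  simp only [hgram]
  rw [← Finset.card_filter]
  exact sq_dvd_card_det_add_symm_ne_zero _ (B.weightedGram_isSymm x) _ _

/-- A linear relation between at most three rows forces the number of weights with an invertible
weighted Gram matrix to be divisible by `q ^ 2`. -/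
theorem sq_dvd_nonsingularCount_of_relation (B : Matrix ι n K) (c : ι → K) (hc : c ≠ 0)
    (hrel : c ᵥ* B = 0) (hsupp : #{i | c i ≠ 0} ≤ 3) (h3 : 3 ≤ Fintype.card ι)
    (hcard : Fintype.card n + 2 ≤ Fintype.card ι) :
    Fintype.card K ^ 2 ∣ B.nonsingularCount := by
  -- The support is padded to exactly three rows, so shorter relations appear as vanishing
  -- coefficients.
  obtain ⟨T, hsub, -, hT⟩ := Finset.exists_subsuperset_card_eq
    (Finset.subset_univ (univ.filter fun i => c i ≠ 0)) hsupp (by rwa [Finset.card_univ])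
  obtain ⟨e, he⟩ := Function.ne_iff.1 hc
  have he : c e ≠ 0 := he
  have heT : e ∈ T := hsub (by simp [he])
  have hT2 : #(T.erase e) = 2 := by rw [Finset.card_erase_of_mem heT, hT]
  obtain ⟨f, g, hfg, hTfg⟩ := Finset.card_eq_two.1 hT2
  have hfe : f ≠ e := Finset.ne_of_mem_erase (by rw [hTfg]; simp : f ∈ T.erase e)
  have hge : g ≠ e := Finset.ne_of_mem_erase (by rw [hTfg]; simp : g ∈ T.erase e)
  have hsum : ∀ j, c e * B e j + (c f * B f j + c g * B g j) = 0 := by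
    intro j
    have h1 : ∑ i, c i * B i j = 0 := congrFun hrel j
    rw [← Finset.sum_subset (Finset.subset_univ T), ← Finset.add_sum_erase _ _ heT, hTfg,
      Finset.sum_pair hfg] at h1
    · exact h1
    · intro i _ hi
      have : c i = 0 := by
        by_contra h0
        exact hi (hsub (by simp [h0]))
      rw [this, zero_mul]
  have hBe : B e = (-(c f) / c e) • B f + (-(c g) / c e) • B g := by
    ext j
    simp only [Pi.add_apply, Pi.smul_apply, smul_eq_mul]
    field_simp
    linear_combination hsum j
  by_cases hf : c f = 0
  · exact B.sq_dvd_nonsingularCount_of_proportional hge _ (by simpa [hf] using hBe) hcard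
  by_cases hg : c g = 0
  · exact B.sq_dvd_nonsingularCount_of_proportional hfe _ (by simpa [hg] using hBe) hcard
  exact B.sq_dvd_nonsingularCount_of_three_term hfe.symm hge.symm hfg
    (div_ne_zero (neg_ne_zero.2 hf) he) (div_ne_zero (neg_ne_zero.2 hg) he) hBe

/-- The **Cauchy-Binet formula** for a weighted Gram matrix. The squares of the maximal minors are
given by a function `c` on the sets of rows. -/
theorem det_weightedGram {R : Type*} [CommRing R] (B : Matrix ι n R) (c : Finset ι → R)
    (hc : ∀ f : n → ι, Function.Injective f →
      (B.submatrix f id).det ^ 2 = c (Finset.univ.image f))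
    (hc₀ : ∀ I : Finset ι, #I ≠ Fintype.card n → c I = 0) (x : ι → R) :
    (B.weightedGram x).det = ∑ I : Finset ι, c I * ∏ i ∈ I, x i := by
  have hexp : (B.weightedGram x).det = ∑ f : n → ι,
      (∏ j, x (f j)) * (∏ j, B (f j) j) * (B.submatrix f id).det := by
    have hrow : B.weightedGram x = fun j => ∑ i, (x i * B i j) • B i := by
      ext j k
      rw [weightedGram_apply, Finset.sum_apply]
      exact Finset.sum_congr rfl fun i _ => by rw [Pi.smul_apply, smul_eq_mul, mul_assoc]
    rw [hrow]
    have h1 := (detRowAlternating (n := n) (R := R)).toMultilinearMap.map_sum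
      (fun (j : n) (i : ι) => (x i * B i j) • B i)
    refine h1.trans (Finset.sum_congr rfl fun f _ => ?_)
    rw [MultilinearMap.map_smul_univ, Finset.prod_mul_distrib]
    rfl
  rw [hexp, ← Finset.sum_fiberwise _ (fun f : n → ι => Finset.univ.image f)]
  refine Finset.sum_congr rfl fun I _ => ?_
  have hinj : ∀ f : n → ι, ¬ Function.Injective f → (B.submatrix f id).det = 0 := by
    intro f hf
    simp only [Function.Injective, not_forall] at hf
    obtain ⟨a, b, hab, hne⟩ := hf
    exact det_zero_of_row_eq hne (by ext j; simp [hab])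
  by_cases hI : #I = Fintype.card n
  · obtain ⟨e⟩ : Nonempty (n ≃ I) := Fintype.card_eq.1 (by rw [Fintype.card_coe, hI])
    let f₀ : n → ι := fun j => e j
    have hf₀ : Function.Injective f₀ := Subtype.val_injective.comp e.injective
    have himage : Finset.univ.image f₀ = I := by
      ext i
      simp only [Finset.mem_image, Finset.mem_univ, true_and]
      exact ⟨fun ⟨j, hj⟩ => hj ▸ (e j).2, fun hi => ⟨e.symm ⟨i, hi⟩, by simp [f₀]⟩⟩
    -- Only injective `f` contribute, and those with image `I` are the permutations of one
    -- enumeration `f₀`.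
    have hbij : ∑ f with Finset.univ.image f = I,
        (∏ j, x (f j)) * (∏ j, B (f j) j) * (B.submatrix f id).det =
        ∑ σ : Equiv.Perm n, (∏ j, x (f₀ (σ j))) * (∏ j, B (f₀ (σ j)) j) *
          (B.submatrix (f₀ ∘ σ) id).det := by
      symm
      refine Finset.sum_bij_ne_zero (fun σ _ _ => f₀ ∘ σ) ?_ ?_ ?_ ?_
      · intro σ _ _
        simp only [Finset.mem_filter, Finset.mem_univ, true_and]
        rw [← Finset.image_image, Finset.image_univ_equiv, himage]
      · intro σ _ _ τ _ _ h
        ext j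
        exact hf₀ (congrFun h j)
      · intro f hf hne
        simp only [Finset.mem_filter, Finset.mem_univ, true_and] at hf
        have hfinj : Function.Injective f := by
          by_contra h
          exact hne (by rw [hinj f h, mul_zero])
        have hmem : ∀ j, f j ∈ I := fun j => by
          rw [← hf]; exact Finset.mem_image_of_mem _ (Finset.mem_univ _)
        have hσ : Function.Injective fun j => e.symm ⟨f j, hmem j⟩ := by
          intro a b hab
          have := e.symm.injective hab
          exact hfinj (congrArg Subtype.val this)
        have hfσ : f₀ ∘ (Equiv.ofBijective _ (Finite.injective_iff_bijective.1 hσ)) = f := by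
          ext j
          simp [f₀]
        refine ⟨Equiv.ofBijective _ (Finite.injective_iff_bijective.1 hσ), Finset.mem_univ _, ?_,
          hfσ⟩
        intro h0
        apply hne
        rw [← hfσ]
        exact h0
      · intro σ _ _
        rfl
    have hperm : ∀ σ : Equiv.Perm n, (B.submatrix (f₀ ∘ σ) id).det =
        Equiv.Perm.sign σ * (B.submatrix f₀ id).det := fun σ => by
      rw [← det_permute σ (B.submatrix f₀ id)]
      rfl
    have hprod : ∀ σ : Equiv.Perm n, ∏ j, x (f₀ (σ j)) = ∏ i ∈ I, x i := fun σ => by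
      rw [Equiv.prod_comp σ fun j => x (f₀ j), ← himage, Finset.prod_image fun a _ b _ h => hf₀ h]
    rw [hbij, ← himage, ← hc f₀ hf₀, himage, sq]
    nth_rewrite 2 [det_apply']
    rw [Finset.mul_sum, Finset.sum_mul]
    refine Finset.sum_congr rfl fun σ _ => ?_
    rw [hperm, hprod]
    simp only [submatrix_apply, id]
    ring
  · rw [hc₀ I hI, zero_mul]
    refine Finset.sum_eq_zero fun f hf => ?_
    rw [hinj f, mul_zero]
    intro h
    apply hI
    simp only [Finset.mem_filter, Finset.mem_univ, true_and] at hf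
    rw [← hf, Finset.card_image_of_injective _ h, Finset.card_univ]

end Matrix

end FewRelations

/-! ### Cuts, spanning trees and the cycle lattice -/

section GraphCycles

open Matrix Finset

/-- The rank-nullity theorem over the integers. -/
theorem LinearMap.finrank_range_add_finrank_ker_int {M N : Type*} [AddCommGroup M]
    [AddCommGroup N] [Module.Finite ℤ M] (f : M →ₗ[ℤ] N) :
    Module.finrank ℤ (LinearMap.range f) + Module.finrank ℤ (LinearMap.ker f) =
      Module.finrank ℤ M := by
  rw [← f.quotKerEquivRange.finrank_eq, Submodule.finrank_quotient_add_finrank]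

namespace Graph

namespace Orientation

variable {α β : Type*} {G : Graph α β} (o : G.Orientation)

/-- A set `T` of edges spans the graph if no nonempty proper set of vertices is separated from its
complement in the subgraph with the edges `T`. -/
def Spans (T : Finset E(G)) : Prop :=
  ∀ A : Set V(G), A.Nonempty → (∀ e ∈ T, (o.src e ∈ A ↔ o.tgt e ∈ A)) → A = Set.univ

theorem restrict_isConnected_iff_spans (hV : V(G).Nonempty) (T : Finset E(G)) :
    (G.restrict (Subtype.val '' (T : Set E(G)))).IsConnected ↔ o.Spans T := by
  constructor
  · rintro ⟨-, hconn⟩ A ⟨a, ha⟩ hA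
    rw [Set.eq_univ_iff_forall]
    intro v
    have hpath := hconn a a.2 v v.2
    suffices h : ∀ y : α, Relation.ReflTransGen
        (G.restrict (Subtype.val '' (T : Set E(G)))).Adj a y → ∃ hy : y ∈ V(G), ⟨y, hy⟩ ∈ A from
      (h v hpath).2
    intro y hy
    induction hy with
    | refl => exact ⟨a.2, ha⟩
    | tail _ hadj ih =>
      obtain ⟨hx, hxA⟩ := ih
      obtain ⟨_, ⟨e, he, rfl⟩, hlink⟩ := hadj
      refine ⟨hlink.right_mem, ?_⟩
      rcases hlink.eq_and_eq_or_eq_and_eq (o.isLink e) with ⟨h1, h2⟩ | ⟨h1, h2⟩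
      · have h3 := (hA e he).1 (by convert hxA; exact h1.symm)
        convert h3
      · have h3 := (hA e he).2 (by convert hxA; exact h1.symm)
        convert h3
  · intro h
    refine ⟨hV, fun u hu v hv => ?_⟩
    have huniv := h {w : V(G) | Relation.ReflTransGen
      (G.restrict (Subtype.val '' (T : Set E(G)))).Adj u w} ⟨⟨u, hu⟩, .refl⟩ ?_
    · exact Set.eq_univ_iff_forall.1 huniv ⟨v, hv⟩
    · intro e he
      have hadj : (G.restrict (Subtype.val '' (T : Set E(G)))).Adj (o.src e) (o.tgt e) :=
        ⟨e, ⟨e, he, rfl⟩, o.isLink e⟩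
      exact ⟨fun h => h.tail hadj, fun h => h.tail hadj.symm⟩

theorem spans_univ [Fintype E(G)] (hG : G.IsConnected) : o.Spans univ := by
  rw [← o.restrict_isConnected_iff_spans hG.1]
  simpa using hG

open Classical in
theorem isSpanningTree_iff (hV : V(G).Nonempty) (T : Finset E(G)) :
    G.IsSpanningTree T ↔ o.Spans T ∧ ∀ e ∈ T, ¬ o.Spans (T.erase e) := by
  have herase : ∀ e : E(G), (G.restrict (Subtype.val '' (T : Set E(G)))).deleteEdges {(e : β)} =
      G.restrict (Subtype.val '' ((T.erase e : Finset E(G)) : Set E(G))) := by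
    intro e
    refine Graph.ext rfl fun f x y => ?_
    simp only [deleteEdges_isLink, restrict_isLink, Finset.coe_erase, Set.mem_singleton_iff,
      Set.mem_image, Set.mem_sdiff, Finset.mem_coe]
    constructor
    · rintro ⟨⟨⟨f, hf, rfl⟩, hl⟩, hne⟩
      exact ⟨⟨f, ⟨hf, fun h => hne (congrArg _ h)⟩, rfl⟩, hl⟩
    · rintro ⟨⟨f, ⟨hf, hne⟩, rfl⟩, hl⟩
      exact ⟨⟨⟨f, hf, rfl⟩, hl⟩, fun h => hne (Subtype.ext h)⟩
  rw [IsSpanningTree, IsTree, o.restrict_isConnected_iff_spans hV]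
  refine and_congr_right fun _ => ⟨fun h e he => ?_, fun h e he => ?_⟩
  · rw [← o.restrict_isConnected_iff_spans hV, ← herase]
    exact h e ⟨e.2, e, he, rfl⟩
  · obtain ⟨-, e, heT, rfl⟩ := he
    rw [herase, o.restrict_isConnected_iff_spans hV]
    exact h e heT

variable [Fintype E(G)] [Fintype V(G)]

theorem incidence_mulVec (φ : V(G) → ℤ) :
    o.incidence *ᵥ φ = fun e => φ (o.src e) - φ (o.tgt e) := by
  ext e
  simp [Matrix.mulVec, dotProduct, incidence, sub_mul, Finset.sum_sub_distrib]

theorem mem_cycleLattice_iff (f : E(G) → ℤ) :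
    f ∈ o.cycleLattice ↔ ∀ φ : V(G) → ℤ, ∑ e, f e * (φ (o.src e) - φ (o.tgt e)) = 0 := by
  have h : ∀ φ : V(G) → ℤ,
      ∑ e, f e * (φ (o.src e) - φ (o.tgt e)) = f ᵥ* o.incidence ⬝ᵥ φ := fun φ => by
    rw [← dotProduct_mulVec, incidence_mulVec]
    rfl
  simp only [h, cycleLattice, LinearMap.mem_ker, vecMulLinear_apply]
  exact ⟨fun h0 φ => by rw [h0, zero_dotProduct], fun h0 => dotProduct_eq_zero _ h0⟩

open Classical in
/-- Only the edges which connect a set of vertices with its complement contribute to the flow out of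
the set. -/
theorem cut_sum {f : E(G) → ℤ} (hf : f ∈ o.cycleLattice) (A : Set V(G)) {e₀ : E(G)}
    (he₀ : ¬ (o.src e₀ ∈ A ↔ o.tgt e₀ ∈ A))
    (h : ∀ e ≠ e₀, f e = 0 ∨ (o.src e ∈ A ↔ o.tgt e ∈ A)) : f e₀ = 0 := by
  have h0 := (o.mem_cycleLattice_iff f).1 hf fun v => if v ∈ A then 1 else 0
  rw [Finset.sum_eq_single e₀] at h0
  · rcases mul_eq_zero.1 h0 with h1 | h1
    · exact h1
    · exfalso
      apply he₀
      by_cases h2 : o.src e₀ ∈ A <;> by_cases h3 : o.tgt e₀ ∈ A <;> simp_all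
  · intro e _ hne
    rcases h e hne with h1 | h1
    · rw [h1, zero_mul]
    · simp [h1]
  · simp

-- Deleting an edge of a tree opens a cut which no other tree edge crosses, so a flow supported on
-- the tree vanishes on that edge.
open Classical in
theorem eq_zero_of_mem_cycleLattice {T : Finset E(G)} (hT : o.Spans T)
    (hmin : ∀ e ∈ T, ¬ o.Spans (T.erase e)) {f : E(G) → ℤ} (hf : f ∈ o.cycleLattice)
    (hfT : ∀ e ∉ T, f e = 0) : f = 0 := by
  ext e
  by_cases he : e ∈ T
  swap
  · exact hfT e he
  have h := hmin e he
  simp only [Spans, not_forall] at h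
  obtain ⟨A, hne, hA, huniv⟩ := h
  refine o.cut_sum hf A (fun h0 => huniv (hT A hne fun e' he' => ?_)) fun e' hne' => ?_
  · by_cases h1 : e' = e
    · rwa [h1]
    · exact hA e' (Finset.mem_erase.2 ⟨h1, he'⟩)
  · by_cases h1 : e' ∈ T
    · exact Or.inr (hA e' (Finset.mem_erase.2 ⟨hne', h1⟩))
    · exact Or.inl (hfT e' h1)

open Classical in
/-- If `T` spans the graph, then any two vertices are joined by a chain of edges in `T`. -/
theorem Spans.exists_chain {o : G.Orientation} {T : Finset E(G)} (hT : o.Spans T) (u v : V(G)) :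
    ∃ g : E(G) → ℤ, (∀ e ∉ T, g e = 0) ∧
      ∀ φ : V(G) → ℤ, ∑ e, g e * (φ (o.src e) - φ (o.tgt e)) = φ u - φ v := by
  have huniv := hT {v | ∃ g : E(G) → ℤ, (∀ e ∉ T, g e = 0) ∧
    ∀ φ : V(G) → ℤ, ∑ e, g e * (φ (o.src e) - φ (o.tgt e)) = φ u - φ v} ⟨u, 0, by simp⟩ ?_
  · exact Set.eq_univ_iff_forall.1 huniv v
  · intro e he
    constructor
    · rintro ⟨g, hg, hφ⟩
      refine ⟨g + Pi.single e 1, fun e' he' => ?_, fun φ => ?_⟩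
      · rw [Pi.add_apply, hg e' he', Pi.single_eq_of_ne (by rintro rfl; exact he' he), add_zero]
      · simp [add_mul, Finset.sum_add_distrib, hφ, Pi.single_apply]
    · rintro ⟨g, hg, hφ⟩
      refine ⟨g - Pi.single e 1, fun e' he' => ?_, fun φ => ?_⟩
      · rw [Pi.sub_apply, hg e' he', Pi.single_eq_of_ne (by rintro rfl; exact he' he), sub_zero]
      · simp [sub_mul, Finset.sum_sub_distrib, hφ, Pi.single_apply]

-- The required cycle is a combination of fundamental cycles: each edge outside `T` is closed up by
-- a chain in `T`.
open Classical in
theorem Spans.exists_cycle {o : G.Orientation} {T : Finset E(G)} (hT : o.Spans T) (r : E(G) → ℤ) :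
    ∃ f ∈ o.cycleLattice, ∀ e ∉ T, f e = r e := by
  choose g hg hφ using fun e => hT.exists_chain (o.src e) (o.tgt e)
  refine ⟨∑ e ∈ Tᶜ, r e • (Pi.single e 1 - g e), Submodule.sum_mem _ fun e _ =>
    Submodule.smul_mem _ _ ((o.mem_cycleLattice_iff _).2 fun φ => ?_), fun e he => ?_⟩
  · simp [sub_mul, Finset.sum_sub_distrib, hφ, Pi.single_apply]
  · rw [Finset.sum_apply, Finset.sum_eq_single e]
    · simp [hg _ e he]
    · intro e' _ hne
      simp [hg _ e he, Pi.single_eq_of_ne hne.symm]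
    · simp [he]

-- A cycle is determined by its values off the tree, and these values can be prescribed freely over
-- `ℤ`.
open Classical in
theorem card_eq_betti_of_isSpanningTree (hV : V(G).Nonempty) {I : Finset E(G)}
    (hI : G.IsSpanningTree Iᶜ) : #I = o.betti := by
  rw [o.isSpanningTree_iff hV] at hI
  let L : o.cycleLattice →ₗ[ℤ] (I → ℤ) :=
    (LinearMap.funLeft ℤ ℤ (Subtype.val : I → E(G))).comp o.cycleLattice.subtype
  have hinj : Function.Injective L := by
    rw [injective_iff_map_eq_zero]
    intro f hf
    refine Subtype.ext (o.eq_zero_of_mem_cycleLattice hI.1 hI.2 f.2 fun e he => ?_)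
    exact congrFun hf ⟨e, by simpa using he⟩
  have hsurj : Function.Surjective L := by
    intro r
    obtain ⟨f, hf, hfr⟩ := hI.1.exists_cycle fun e => if h : e ∈ I then r ⟨e, h⟩ else 0
    refine ⟨⟨f, hf⟩, funext fun e => ?_⟩
    have := hfr e (by simp)
    rw [dif_pos e.2] at this
    exact this
  have := (LinearEquiv.ofBijective L ⟨hinj, hsurj⟩).finrank_eq
  rw [Module.finrank_fintype_fun_eq_card, Fintype.card_coe] at this
  exact this.symm

/-- The first Betti number is at least `N - V + 1`. -/
theorem edgeCount_lt_card_add_betti (hV : V(G).Nonempty) :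
    G.edgeCount + 1 ≤ Fintype.card V(G) + o.betti := by
  classical
  obtain ⟨v₀, hv₀⟩ := hV
  let s : (V(G) → ℤ) →ₗ[ℤ] ℤ := ∑ v, LinearMap.proj v
  have hs : Function.Surjective s := fun t =>
    ⟨Pi.single ⟨v₀, hv₀⟩ t, by simp [s, LinearMap.sum_apply]⟩
  have h1 := LinearMap.finrank_range_add_finrank_ker_int s
  rw [LinearMap.range_eq_top.2 hs, finrank_top, Module.finrank_self,
    Module.finrank_fintype_fun_eq_card] at h1
  have h2 := LinearMap.finrank_range_add_finrank_ker_int o.incidence.vecMulLinear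
  rw [Module.finrank_fintype_fun_eq_card] at h2
  have h3 : LinearMap.range o.incidence.vecMulLinear ≤ LinearMap.ker s := by
    rintro _ ⟨f, rfl⟩
    rw [LinearMap.mem_ker]
    have h4 : f ᵥ* o.incidence ⬝ᵥ 1 = 0 := by
      rw [← dotProduct_mulVec, incidence_mulVec]
      simp
    simpa [s, LinearMap.sum_apply, dotProduct] using h4
  have h5 := Submodule.finrank_mono h3
  have h6 : o.betti = Module.finrank ℤ (LinearMap.ker o.incidence.vecMulLinear) := rfl
  rw [edgeCount]
  omega

/-! ### Minors of the cycle matrix and the matrix-tree theorem -/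

variable (b : Module.Basis (Fin o.betti) ℤ o.cycleLattice)

/-- The matrix of the coefficients of the edges in a basis of the cycle lattice. -/
noncomputable def cycleMatrix : Matrix E(G) (Fin o.betti) ℤ := of fun e i => (b i : E(G) → ℤ) e

theorem cycleMatrix_mulVec (a : Fin o.betti → ℤ) :
    o.cycleMatrix b *ᵥ a = (∑ i, a i • b i : o.cycleLattice) := by
  ext e
  simp [cycleMatrix, Matrix.mulVec, dotProduct, Finset.sum_apply, mul_comm]

theorem exists_cycleMatrix_mulVec_eq {f : E(G) → ℤ} (hf : f ∈ o.cycleLattice) :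
    ∃ a, o.cycleMatrix b *ᵥ a = f :=
  ⟨b.repr ⟨f, hf⟩, by rw [cycleMatrix_mulVec, b.sum_repr]⟩

open Classical in
theorem det_cycleMatrix_submatrix_sq (hG : G.IsConnected) {f : Fin o.betti → E(G)}
    (hf : Function.Injective f) :
    ((o.cycleMatrix b).submatrix f id).det ^ 2 =
      if G.IsSpanningTree (univ.image f)ᶜ then 1 else 0 := by
  have hmul : ∀ a, (o.cycleMatrix b).submatrix f id *ᵥ a = (o.cycleMatrix b *ᵥ a) ∘ f :=
    fun a => rfl
  split_ifs with hT
  · rw [o.isSpanningTree_iff hG.1] at hT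
    have hsurj : Function.Surjective ((o.cycleMatrix b).submatrix f id).mulVec := by
      intro r
      obtain ⟨z, hz, hzr⟩ := hT.1.exists_cycle (Function.extend f r 0)
      obtain ⟨a, ha⟩ := o.exists_cycleMatrix_mulVec_eq b hz
      refine ⟨a, ?_⟩
      rw [hmul, ha]
      ext j
      rw [Function.comp_apply, hzr (f j) (by simp), hf.extend_apply]
    exact Int.isUnit_sq ((Matrix.isUnit_iff_isUnit_det _).1
      (Matrix.mulVec_surjective_iff_isUnit.1 hsurj))
  · rw [sq_eq_zero_iff]
    by_contra hdet
    refine hT ((o.isSpanningTree_iff hG.1 _).2 ⟨fun A hne hA => ?_, fun e he hspan => ?_⟩)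
    · by_contra huniv
      obtain ⟨e, he⟩ : ∃ e, ¬ (o.src e ∈ A ↔ o.tgt e ∈ A) := by
        by_contra! h
        exact huniv (o.spans_univ hG A hne fun e _ => h e)
      obtain ⟨j, rfl⟩ : ∃ j, f j = e := by
        by_contra! h
        exact he (hA e (by simpa using h))
      -- This column yields a cycle that equals the minor on `f j` and vanishes on the other chosen
      -- edges. As `f j` is then the only edge of the cut that can carry flow, the minor is zero.
      let a := ((o.cycleMatrix b).submatrix f id).adjugate.col j
      have ha : (o.cycleMatrix b *ᵥ a) ∘ f =
          Pi.single j ((o.cycleMatrix b).submatrix f id).det := by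
        rw [← hmul]
        ext k
        have := congrFun (congrFun (((o.cycleMatrix b).submatrix f id).mul_adjugate) k) j
        rw [Matrix.smul_apply, Matrix.one_apply] at this
        rw [Pi.single_apply]
        exact this.trans (by simp)
      have hz : o.cycleMatrix b *ᵥ a ∈ o.cycleLattice := by
        rw [cycleMatrix_mulVec]
        exact Subtype.property _
      have hzero := o.cut_sum hz A he fun e' hne' => ?_
      · apply hdet
        have := congrFun ha j
        rwa [Function.comp_apply, hzero, Pi.single_eq_same, eq_comm] at this
      · by_cases h : ∃ k, f k = e'
        · obtain ⟨k, rfl⟩ := h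
          left
          have := congrFun ha k
          rwa [Pi.single_eq_of_ne (by rintro rfl; exact hne' rfl)] at this
        · right
          exact hA e' (by simpa using h)
    -- If `e` is redundant, some cycle is `1` on `e` but vanishes on all chosen edges, contradicting
    -- the nonzero minor.
    · obtain ⟨z, hz, hzr⟩ := hspan.exists_cycle (Pi.single e 1)
      obtain ⟨a, rfl⟩ := o.exists_cycleMatrix_mulVec_eq b hz
      have ha : a = 0 := by
        refine Matrix.eq_zero_of_mulVec_eq_zero hdet ?_
        rw [hmul]
        ext j
        have hne : f j ≠ e := fun h => by simp [← h] at he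
        rw [Function.comp_apply, hzr (f j) (by simp), Pi.single_eq_of_ne hne, Pi.zero_apply]
      have h1 := hzr e (by simp)
      simp [ha] at h1

open Classical in
/-- The **matrix-tree theorem** for the cycle space. -/
theorem det_weightedGram_cycleMatrix (hG : G.IsConnected) {R : Type*} [CommRing R]
    (x : E(G) → R) :
    (((o.cycleMatrix b).map (Int.cast : ℤ → R)).weightedGram x).det =
      MvPolynomial.aeval x G.graphPolynomial := by
  rw [det_weightedGram _ (fun I => if G.IsSpanningTree Iᶜ then 1 else 0)]
  · rw [graphPolynomial, map_sum, Finset.sum_filter,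
      ← Equiv.sum_comp (Function.Involutive.toPerm _ (compl_involutive (α := Finset E(G))))]
    refine Finset.sum_congr rfl fun I _ => ?_
    simp [Function.Involutive.coe_toPerm, MvPolynomial.aeval_X]
  · intro f hf
    have h1 : ((o.cycleMatrix b).map (Int.cast : ℤ → R)).submatrix f id =
        ((o.cycleMatrix b).submatrix f id).map (Int.castRingHom R) := rfl
    rw [h1, ← RingHom.mapMatrix_apply, ← RingHom.map_det, ← map_pow,
      o.det_cycleMatrix_submatrix_sq b hG hf]
    split_ifs <;> simp
  · intro I hI
    rw [if_neg]
    intro h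
    apply hI
    rw [o.card_eq_betti_of_isSpanningTree hG.1 h, Fintype.card_fin]

/-! ### Small cuts and short relations -/

open Classical in
/-- Double counting: if the ends of the edges outside `S` are merged, then one of the remaining
vertices has at most three non-loop edges. -/
theorem exists_small_cut (π : V(G) → V(G)) (S : Finset E(G))
    (hcard : 2 * #S < 4 * #(univ.image π)) :
    ∃ v ∈ univ.image π, #{e ∈ S | ¬ (π (o.src e) = v ↔ π (o.tgt e) = v)} ≤ 3 := by
  by_contra h
  have h1 := Finset.card_nsmul_le_sum (univ.image π)
    (fun v => #{e ∈ S | ¬ (π (o.src e) = v ↔ π (o.tgt e) = v)}) 4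
    fun v hv => not_le.1 fun h3 => h ⟨v, hv, h3⟩
  have h2 : ∑ v ∈ univ.image π, #{e ∈ S | ¬ (π (o.src e) = v ↔ π (o.tgt e) = v)} ≤ #S * 2 := by
    simp only [Finset.card_filter]
    rw [Finset.sum_comm]
    refine Finset.sum_le_card_nsmul _ _ _ fun e _ => ?_
    rw [← Finset.card_filter]
    refine (Finset.card_le_card (t := {π (o.src e), π (o.tgt e)}) fun v hv => ?_).trans
      Finset.card_le_two
    simp only [Finset.mem_filter] at hv
    simp only [Finset.mem_insert, Finset.mem_singleton]
    by_contra! h3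
    exact hv.2 ⟨fun h => absurd h.symm h3.1, fun h => absurd h.symm h3.2⟩
  rw [smul_eq_mul] at h1
  omega

open Classical in
/-- A set of `2 h - 1` edges which misses at most one edge of a graph with at most `2 h` edges has a
small cut, which gives a short relation between the rows of the cycle matrix. -/
theorem exists_short_relation (hG : G.IsConnected) (hh : 3 ≤ o.betti)
    (hN : G.edgeCount ≤ 2 * o.betti) (S : Finset E(G)) (hS : #S + 1 = 2 * o.betti)
    (K : Type*) [Field K] :
    ∃ c : S → K, c ≠ 0 ∧
      c ᵥ* ((o.cycleMatrix b).map (Int.cast : ℤ → K)).submatrix (Subtype.val : S → E(G)) id = 0 ∧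
      #{e | c e ≠ 0} ≤ 3 := by
  have hV := o.edgeCount_lt_card_add_betti hG.1
  have hSc : #S + #Sᶜ = G.edgeCount := by rw [Finset.card_add_card_compl, edgeCount]
  obtain ⟨π, hπ, hcard⟩ : ∃ π : V(G) → V(G), (∀ e ∉ S, π (o.src e) = π (o.tgt e)) ∧
      o.betti ≤ #(univ.image π) := by
    by_cases h0 : #Sᶜ = 0
    · have hSu : S = univ := by simpa using h0
      refine ⟨id, fun e he => absurd (hSu ▸ Finset.mem_univ e) he, ?_⟩
      rw [Finset.image_id, Finset.card_univ]
      omega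
    · have h1 : #Sᶜ = 1 := by omega
      obtain ⟨e₀, he₀⟩ := Finset.card_eq_one.1 h1
      -- Merging the ends of the missing edge keeps it out of every cut. It costs at most one
      -- vertex, and here there are at least `h + 1`.
      refine ⟨Function.update id (o.tgt e₀) (o.src e₀), fun e he => ?_, ?_⟩
      · have : e = e₀ := by
          rw [← Finset.mem_singleton, ← he₀]
          simpa using he
        rw [this, Function.update_self]
        by_cases h2 : o.src e₀ = o.tgt e₀
        · rw [h2, Function.update_self]
        · rw [Function.update_of_ne h2, id]
      · have hsub : univ.erase (o.tgt e₀) ⊆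
            univ.image (Function.update id (o.tgt e₀) (o.src e₀)) := by
          intro v hv
          refine Finset.mem_image.2 ⟨v, Finset.mem_univ _, ?_⟩
          rw [Function.update_of_ne (Finset.ne_of_mem_erase hv), id]
        have h3 := Finset.card_le_card hsub
        rw [Finset.card_erase_of_mem (Finset.mem_univ _), Finset.card_univ] at h3
        omega
  obtain ⟨v, hv, hcut⟩ := o.exists_small_cut π S (by omega)
  let φ : V(G) → ℤ := fun w => if π w = v then 1 else 0
  let d : E(G) → ℤ := fun e => φ (o.src e) - φ (o.tgt e)
  -- The coboundary `d` takes only the values `0` and `±1`, so its support is the same in every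
  -- characteristic.
  have hd : ∀ e, ((d e : ℤ) : K) ≠ 0 ↔ ¬ (π (o.src e) = v ↔ π (o.tgt e) = v) := by
    intro e
    by_cases h1 : π (o.src e) = v <;> by_cases h2 : π (o.tgt e) = v <;> simp [d, φ, h1, h2]
  have hdS : ∀ e ∉ S, d e = 0 := fun e he => by simp [d, φ, hπ e he]
  refine ⟨fun e => (d e : K), fun h0 => ?_, ?_, ?_⟩
  -- A proper nonempty vertex set is crossed by some edge since `G` is connected, so the relation is
  -- nontrivial.
  · have hproper : {w | π w = v} ≠ Set.univ := by
      intro huniv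
      have hsub : univ.image π ⊆ {v} := by
        intro u hu
        obtain ⟨w, -, rfl⟩ := Finset.mem_image.1 hu
        exact Finset.mem_singleton.2 (Set.eq_univ_iff_forall.1 huniv w)
      have := Finset.card_le_card hsub
      rw [Finset.card_singleton] at this
      omega
    obtain ⟨w, -, hw⟩ := Finset.mem_image.1 hv
    refine hproper (o.spans_univ hG _ ⟨w, hw⟩ fun e _ => ?_)
    by_contra hne
    by_cases heS : e ∈ S
    · exact (hd e).2 hne (congrFun h0 ⟨e, heS⟩)
    · exact (hd e).2 hne (by rw [hdS e heS, Int.cast_zero])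
  · ext i
    have h1 := (o.mem_cycleLattice_iff _).1 (b i).2 φ
    rw [← Finset.sum_subset (Finset.subset_univ S)] at h1
    · have h2 := congrArg (Int.cast : ℤ → K) h1
      rw [← Finset.sum_coe_sort, Int.cast_sum, Int.cast_zero] at h2
      rw [Pi.zero_apply, ← h2]
      refine Finset.sum_congr rfl fun e _ => ?_
      simp [cycleMatrix, d, mul_comm]
    · intro e _ he
      rw [show φ (o.src e) - φ (o.tgt e) = 0 from hdS e he, mul_zero]
  · refine le_trans (le_of_eq ?_) hcut
    simp only [hd]
    rw [← Finset.card_map (Function.Embedding.subtype (· ∈ S))]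
    congr 1
    ext e
    simp [and_comm]

end Orientation

end Graph

end GraphCycles

/-! ### Common zeros of propagators and comparison of the point counts -/

section MomentumSpace

open Matrix Finset

variable {K : Type*} [Field K] [Fintype K] [DecidableEq K]

namespace Matrix

variable {n ι : Type*} [Fintype n] [Fintype ι] [DecidableEq n] [DecidableEq ι]

/-- The common zeros of the quadrics `Q(B_i p)` with `i ∈ S`. -/
def commonZeros (B : Matrix ι n K) (S : Finset ι) : Finset (n × Fin 4 → K) :=
  {p | ∀ i ∈ S, splitQuadric (fun a => ∑ j, B i j * p (j, a)) = 0}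

theorem card_commonZeros_mul (B : Matrix ι n K) (S : Finset ι) :
    #(B.commonZeros S) * Fintype.card K ^ #S = Fintype.card K ^ (2 * Fintype.card n) *
      (B.submatrix (Subtype.val : S → ι) id).kernelSqSum := by
  have h := card_common_zeros_mul (B.submatrix (Subtype.val : S → ι) id)
  rw [Fintype.card_coe] at h
  rw [← h, commonZeros]
  congr 3
  ext p
  simp

theorem card_commonZeros_eq (B : Matrix ι n K) (S : Finset ι) (hS : #S ≤ 2 * Fintype.card n) :
    #(B.commonZeros S) = Fintype.card K ^ (2 * Fintype.card n - #S) *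
      (B.submatrix (Subtype.val : S → ι) id).kernelSqSum := by
  have h := B.card_commonZeros_mul S
  have hq : 0 < Fintype.card K ^ #S := pow_pos Fintype.card_pos _
  rw [← Nat.sub_add_cancel hS, pow_add, mul_right_comm] at h
  exact Nat.eq_of_mul_eq_mul_right hq h

theorem card_commonZeros_univ (B : Matrix ι n K) (h : 2 * Fintype.card n = Fintype.card ι) :
    #(B.commonZeros univ) = B.kernelSqSum := by
  have hz := B.card_common_zeros_mul
  have hq : 0 < Fintype.card K ^ Fintype.card ι := pow_pos Fintype.card_pos _
  rw [h, mul_comm (_ ^ _)] at hz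
  rw [← Nat.eq_of_mul_eq_mul_right hq hz, commonZeros]
  simp

/-- The prefactor `q ^ (2h - |S|)` suffices for `|S| ≤ 2h - 3`. For `|S| = 2h - 2` one more `q`
comes from `|S| > h`; for `|S| = 2h - 1` the missing `q ^ 2` comes from the invertible count. -/
theorem cube_dvd_card_commonZeros (B : Matrix ι n K) (S : Finset ι) (hn : 3 ≤ Fintype.card n)
    (hS : #S < 2 * Fintype.card n)
    (h : #S + 1 = 2 * Fintype.card n →
      Fintype.card K ^ 2 ∣ (B.submatrix (Subtype.val : S → ι) id).nonsingularCount) :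
    Fintype.card K ^ 3 ∣ #(B.commonZeros S) := by
  rw [B.card_commonZeros_eq S hS.le]
  by_cases h1 : #S + 1 = 2 * Fintype.card n
  · rw [show 2 * Fintype.card n - #S = 1 by omega, show 3 = 1 + 2 from rfl, pow_add]
    exact mul_dvd_mul_left _ (sq_dvd_kernelSqSum_of_nonsingularCount _ (h h1))
  by_cases h2 : #S + 2 = 2 * Fintype.card n
  · rw [show 2 * Fintype.card n - #S = 2 by omega, show 3 = 2 + 1 from rfl, pow_succ]
    refine mul_dvd_mul_left _ (card_dvd_kernelSqSum _ ?_)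
    rw [Fintype.card_coe]
    omega
  · exact Dvd.dvd.mul_right (pow_dvd_pow _ (by omega)) _

/-- Inclusion-exclusion for the zeros of the product of the quadrics `Q(B_i p)`. -/
theorem card_zeros_prod_quadric (B : Matrix ι n K) :
    (#{p : n × Fin 4 → K | ∏ i, splitQuadric (fun a => ∑ j, B i j * p (j, a)) = 0} : ℤ) =
      (Fintype.card K : ℤ) ^ (4 * Fintype.card n) -
        ∑ S : Finset ι, (-1) ^ #S * (#(B.commonZeros S) : ℤ) := by
  have h := Finset.inclusion_exclusion_card_inf_compl (univ : Finset ι)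
    fun i => B.commonZeros {i}
  have h1 : ∀ S : Finset ι, S.inf (fun i => B.commonZeros {i}) = B.commonZeros S := by
    intro S
    ext p
    simp [Finset.mem_inf, commonZeros]
  have h2 : (univ : Finset ι).inf (fun i => (B.commonZeros {i})ᶜ) =
      ({p | ∏ i, splitQuadric (fun a => ∑ j, B i j * p (j, a)) = 0} : Finset (n × Fin 4 → K))ᶜ := by
    ext p
    simp [Finset.mem_inf, commonZeros, Finset.prod_eq_zero_iff]
  simp only [h1, h2, Finset.powerset_univ] at h
  rw [← h, Finset.card_compl, Nat.cast_sub (Finset.card_le_univ _)]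
  simp [mul_comm]

/-- The weights with a singular and with a nonsingular Gram matrix are complementary. -/
theorem card_det_weightedGram_eq_zero (B : Matrix ι n K) :
    #{x : ι → K | (B.weightedGram x).det = 0} + B.nonsingularCount =
      Fintype.card K ^ Fintype.card ι := by
  rw [nonsingularCount, Finset.card_filter_add_card_filter_not, Finset.card_univ, Fintype.card_fun]

end Matrix

theorem cast_div_sq_eq_of_cube_dvd {q a b : ℕ} (hq : q ≠ 0) (ha : q ^ 2 ∣ a) (hb : q ^ 2 ∣ b)
    (h : (q : ℤ) ^ 3 ∣ a - b) : ((a / q ^ 2 : ℕ) : ZMod q) = ((b / q ^ 2 : ℕ) : ZMod q) := by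
  obtain ⟨a, rfl⟩ := ha
  obtain ⟨b, rfl⟩ := hb
  have hq2 : 0 < q ^ 2 := by positivity
  rw [Nat.mul_div_cancel_left _ hq2, Nat.mul_div_cancel_left _ hq2, ← Int.cast_natCast,
    ← Int.cast_natCast b, ← sub_eq_zero, ← Int.cast_sub, ZMod.intCast_zmod_eq_zero_iff_dvd]
  obtain ⟨c, hc⟩ := h
  have hq0 : (q : ℤ) ^ 2 ≠ 0 := by positivity
  push_cast at hc
  exact ⟨c, mul_left_cancel₀ hq0 (by linear_combination hc)⟩

namespace Graph.Orientation

variable {α β : Type*} {G : Graph α β} (o : G.Orientation) [Fintype E(G)] [Fintype V(G)]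
  (b : Module.Basis (Fin o.betti) ℤ o.cycleLattice)

open Classical in
theorem pointCount_momentumDenominator :
    pointCount (o.momentumDenominator b) K =
      #{p : Fin o.betti × Fin 4 → K | ∏ e, splitQuadric
        (fun a => ∑ j, (o.cycleMatrix b).map (Int.cast : ℤ → K) e j * p (j, a)) = 0} := by
  rw [pointCount, Nat.card_eq_fintype_card, Fintype.card_subtype]
  refine congrArg Finset.card (Finset.filter_congr fun p _ => ?_)
  simp [momentumDenominator, inversePropagator, edgeMomentum, splitQuadric, cycleMatrix, map_prod]

open Classical in
theorem pointCount_graphPolynomial (hG : G.IsConnected) :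
    pointCount G.graphPolynomial K + ((o.cycleMatrix b).map (Int.cast : ℤ → K)).nonsingularCount =
      Fintype.card K ^ G.edgeCount := by
  rw [edgeCount, ← card_det_weightedGram_eq_zero ((o.cycleMatrix b).map (Int.cast : ℤ → K)),
    pointCount, Nat.card_eq_fintype_card, Fintype.card_subtype]
  simp only [o.det_weightedGram_cycleMatrix b hG]

open Classical in
theorem cube_dvd_card_commonZeros (hG : G.IsConnected) (hh : 3 ≤ o.betti)
    (hN : G.edgeCount ≤ 2 * o.betti) (S : Finset E(G)) (hS : #S < 2 * o.betti) :
    Fintype.card K ^ 3 ∣ #(((o.cycleMatrix b).map (Int.cast : ℤ → K)).commonZeros S) := by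
  refine Matrix.cube_dvd_card_commonZeros _ S (by simpa using hh) (by simpa using hS) fun h => ?_
  rw [Fintype.card_fin] at h
  obtain ⟨c, hc, hrel, hsupp⟩ := o.exists_short_relation b hG hh hN S h K
  refine sq_dvd_nonsingularCount_of_relation _ c hc hrel ?_ ?_ ?_
  · convert hsupp
  · rw [Fintype.card_coe]
    omega
  · rw [Fintype.card_coe, Fintype.card_fin]
    omega

theorem cube_dvd_pointCount_momentumDenominator (hG : G.IsConnected) (hh : 3 ≤ o.betti)
    (hN : G.edgeCount < 2 * o.betti) :
    Fintype.card K ^ 3 ∣ pointCount (o.momentumDenominator b) K := by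
  classical
  suffices h : (Fintype.card K : ℤ) ^ 3 ∣ pointCount (o.momentumDenominator b) K by
    exact_mod_cast h
  rw [o.pointCount_momentumDenominator b, card_zeros_prod_quadric, Fintype.card_fin]
  refine dvd_sub (pow_dvd_pow _ (by omega)) (Finset.dvd_sum fun S _ => Dvd.dvd.mul_left ?_ _)
  exact_mod_cast o.cube_dvd_card_commonZeros b hG hh hN.le S
    ((Finset.card_le_univ S).trans_lt hN)

theorem sq_dvd_pointCount_graphPolynomial (hG : G.IsConnected) (hh : 3 ≤ o.betti)
    (hN : 2 * o.betti = G.edgeCount) : Fintype.card K ^ 2 ∣ pointCount G.graphPolynomial K := by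
  classical
  let b : Module.Basis (Fin o.betti) ℤ o.cycleLattice := Module.finBasis ℤ o.cycleLattice
  have h := o.pointCount_graphPolynomial (K := K) b hG
  refine (Nat.dvd_add_left (sq_dvd_nonsingularCount
    ((o.cycleMatrix b).map (Int.cast : ℤ → K)) ?_ ?_)).1 (h ▸ pow_dvd_pow _ ?_)
  · rw [Fintype.card_fin, hN, edgeCount]
  · rw [Fintype.card_fin]
    omega
  · omega

theorem cube_dvd_pointCount_sub (hG : G.IsConnected) (hh : 3 ≤ o.betti)
    (hN : 2 * o.betti = G.edgeCount) :
    (Fintype.card K : ℤ) ^ 3 ∣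
      pointCount (o.momentumDenominator b) K - pointCount G.graphPolynomial K := by
  classical
  set B := (o.cycleMatrix b).map (Int.cast : ℤ → K) with hB
  have hcard : 2 * Fintype.card (Fin o.betti) = Fintype.card E(G) := by
    rw [Fintype.card_fin, hN, edgeCount]
  have hΨ : (pointCount G.graphPolynomial K : ℤ) =
      (Fintype.card K : ℤ) ^ G.edgeCount - B.nonsingularCount := by
    rw [eq_sub_iff_add_eq]
    exact_mod_cast o.pointCount_graphPolynomial (K := K) b hG
  -- Because `N = 2h` is even, the full intersection enters with the same sign as the invertible
  -- count does for `Ψ_G`.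
  have hsign : (-1 : ℤ) ^ #(univ : Finset E(G)) = 1 := by
    rw [Finset.card_univ, ← hcard, pow_mul, neg_one_sq, one_pow]
  rw [o.pointCount_momentumDenominator b, card_zeros_prod_quadric, Fintype.card_fin, hΨ,
    ← Finset.add_sum_erase _ _ (Finset.mem_univ univ), hsign, one_mul, ← hB,
    B.card_commonZeros_univ hcard]
  have h1 : (Fintype.card K : ℤ) ^ 3 ∣ (Fintype.card K : ℤ) ^ (4 * o.betti) :=
    pow_dvd_pow _ (by omega)
  have h2 : (Fintype.card K : ℤ) ^ 3 ∣ (Fintype.card K : ℤ) ^ G.edgeCount :=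
    pow_dvd_pow _ (by omega)
  have h3 := B.cube_dvd_kernelSqSum_sub_nonsingularCount hcard.le
    (by rw [Fintype.card_fin]; omega)
  have h4 : (Fintype.card K : ℤ) ^ 3 ∣
      ∑ S ∈ univ.erase (univ : Finset E(G)), (-1) ^ #S * (#(B.commonZeros S) : ℤ) := by
    refine Finset.dvd_sum fun S hS => Dvd.dvd.mul_left ?_ _
    have hlt : #S < 2 * o.betti := by
      rw [hN, edgeCount]
      exact Finset.card_lt_card (Finset.ssubset_univ_iff.2 (Finset.ne_of_mem_erase hS))
    exact_mod_cast o.cube_dvd_card_commonZeros b hG hh hN.ge S hlt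
  obtain ⟨c₁, hc₁⟩ := h1
  obtain ⟨c₂, hc₂⟩ := h2
  obtain ⟨c₃, hc₃⟩ := h3
  obtain ⟨c₄, hc₄⟩ := h4
  exact ⟨c₁ - c₂ - c₃ - c₄, by linear_combination hc₁ - hc₂ - hc₃ - hc₄⟩

end Graph.Orientation

end MomentumSpace

theorem theorem3p5 {α β : Type*} (G : Graph α β) [Finite V(G)] [Fintype E(G)]
    (hG : G.IsConnected) (o : G.Orientation)
    (b : Module.Basis (Fin o.betti) ℤ o.cycleLattice) (hh : 3 ≤ o.betti)
    (K : Type*) [Field K] [Finite K] :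
    (G.edgeCount < 2 * o.betti →
      HasCInvariant 2 (o.momentumDenominator b) K ∧
        cInvariant 2 (o.momentumDenominator b) K = 0) ∧
    (2 * o.betti = G.edgeCount →
      HasCInvariant 2 (o.momentumDenominator b) K ∧
        HasCInvariant 2 G.graphPolynomial K ∧
        cInvariant 2 (o.momentumDenominator b) K = cInvariant 2 G.graphPolynomial K) := by
  classical
  have := Fintype.ofFinite K
  have := Fintype.ofFinite V(G)
  have hq : Fintype.card K ≠ 0 := Fintype.card_ne_zero
  unfold HasCInvariant cInvariant
  rw [Nat.card_eq_fintype_card]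
  constructor
  · intro hN
    have h := o.cube_dvd_pointCount_momentumDenominator (K := K) b hG hh hN
    have h2 := (pow_dvd_pow (Fintype.card K) (by norm_num : 2 ≤ 3)).trans h
    refine ⟨h2, ?_⟩
    -- Vanishing is the comparison with the point count `0`.
    rw [cast_div_sq_eq_of_cube_dvd hq h2 (dvd_zero _) (by simpa using by exact_mod_cast h)]
    simp
  · intro hN
    have h := o.cube_dvd_pointCount_sub (K := K) b hG hh hN
    have hΨ := o.sq_dvd_pointCount_graphPolynomial (K := K) hG hh hN
    have h2 : Fintype.card K ^ 2 ∣ pointCount (o.momentumDenominator b) K := by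
      have h3 : (Fintype.card K : ℤ) ^ 2 ∣ pointCount G.graphPolynomial K := by exact_mod_cast hΨ
      have h4 := dvd_add ((pow_dvd_pow _ (by norm_num : 2 ≤ 3)).trans h) h3
      rw [sub_add_cancel] at h4
      exact_mod_cast h4
    exact ⟨h2, hΨ, cast_div_sq_eq_of_cube_dvd hq h2 hΨ h⟩
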